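/- An instance of the \textsc{Anonymous Refugees Housing} problem (ARH) consists of a finite simple undirected graph $G=(V,E)$ (the topology), a non-empty finite set $R$ of refugees and a finite set $I$ of inhabitants with $|V|\ge |R|+|I|$, an injective assignment $\iota\colon I\to V$, and, for every inhabitant $i\in I$, a set $A_i\subseteq\{0,1,\dots,\deg(\iota(i))\}$ of approved numbers of refugees. A housing is an injective map $\pi\colon R\to V\setminus\iota(I)$; it is inhabitant-respecting if $|N(\iota(i))\cap\pi(R)|\in A_i$ for every $i\in I$. ARH asks whether an inhabitant-respecting housing exists. \textbf{Theorem.} ARH restricted to instances whose topology $G$ has maximum degree at most $2$ can be solved in polynomial time: there are a deterministic Turing machine $M$ and a polynomial $p$ such that, on the encoding $\langle\mathcal I\rangle$ of any such instance $\mathcal I$ as a word over a fixed finite alphabet (numbers of vertices and refugees in unary, adjacency matrix of $G$, and for every inhabitant the characteristic vectors of $\{\iota(i)\}$ and of $A_i$), $M$ halts after at most $p(|\langle\mathcal I\rangle|)$ steps and outputs whether $\mathcal I$ admits an inhabitant-respecting housing. -/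

import Mathlib

/-- An instance of the Anonymous Refugees Housing problem (ARH): a finite simple undirected graph
(the topology), a set of inhabitants, a non-empty set of refugees, an injective assignment of the
inhabitants to vertices, and for every inhabitant `i` a set of approved numbers of refugees in her
neighbourhood, which is a subset of `{0, …, deg (assignment i)}`. Vertices, inhabitants and
refugees are labelled by initial segments of the natural numbers, as in any machine input. -/
structure ARHInstance where
  numVertices : ℕ
  numInhabitants : ℕ
  numRefugees : ℕ
  topology : SimpleGraph (Fin numVertices)
  [decAdj : DecidableRel topology.Adj]
  assignment : Fin numInhabitants → Fin numVertices
  approval : Fin numInhabitants → Finset ℕ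
  refugees_nonempty : 0 < numRefugees
  agents_le : numRefugees + numInhabitants ≤ numVertices
  assignment_injective : Function.Injective assignment
  approval_subset : ∀ i, approval i ⊆ Finset.range (topology.degree (assignment i) + 1)

attribute [instance] ARHInstance.decAdj

namespace ARHInstance

/-- The vertices of the topology. -/
abbrev Vertex (I : ARHInstance) : Type := Fin I.numVertices

/-- The inhabitants. -/
abbrev Inhabitant (I : ARHInstance) : Type := Fin I.numInhabitants

/-- The refugees. -/
abbrev Refugee (I : ARHInstance) : Type := Fin I.numRefugees

/-- The set of vertices that are not occupied by inhabitants. -/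
def unoccupied (I : ARHInstance) : Set I.Vertex := (Set.range I.assignment)ᶜ

/-- A housing: an injective mapping of the refugees to vertices not occupied by inhabitants. -/
structure Housing (I : ARHInstance) where
  place : I.Refugee → I.unoccupied
  place_injective : Function.Injective place

/-- The set of vertices occupied by refugees in the housing `π`. -/
def Housing.occupied {I : ARHInstance} (π : I.Housing) : Set I.Vertex :=
  Set.range fun r => (π.place r : I.Vertex)

/-- A housing is inhabitant-respecting if every inhabitant approves the number of refugees in her
neighbourhood. -/
def Housing.InhabitantRespecting {I : ARHInstance} (π : I.Housing) : Prop :=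
  ∀ i : I.Inhabitant,
    (I.topology.neighborSet (I.assignment i) ∩ π.occupied).ncard ∈ I.approval i

/-- The question of ARH: is there an inhabitant-respecting housing? -/
def IsYes (I : ARHInstance) : Prop :=
  ∃ π : I.Housing, π.InhabitantRespecting

/-- The number `k` in unary, closed by a comma. -/
def encodeUnary (k : ℕ) : List Computability.Γ' :=
  List.replicate k (.bit true) ++ [.comma]

/-- The characteristic vector of a subset of `{0, …, n - 1}`, closed by a comma. -/
def encodeRow {n : ℕ} (s : Fin n → Bool) : List Computability.Γ' :=
  (List.ofFn fun k => .bit (s k)) ++ [.comma]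

/-- The input word of an instance, over the finite alphabet `Γ'` of bits, brackets and comma:
the number of vertices and the number of refugees in unary; the adjacency matrix of the topology,
row by row; and for every inhabitant the characteristic vectors of her vertex and of her approval
set. (All degrees are at most `numVertices - 1`, so that vectors of length `numVertices` suffice
for the approval sets.) -/
def encode (I : ARHInstance) : List Computability.Γ' :=
  encodeUnary I.numVertices ++ encodeUnary I.numRefugees ++
  [.bra] ++
  (List.ofFn fun u : I.Vertex =>
    encodeRow fun v : I.Vertex => decide (I.topology.Adj u v)).flatten ++
  [.ket, .bra] ++
  (List.ofFn fun i : I.Inhabitant =>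
    encodeRow (fun v : I.Vertex => decide (I.assignment i = v)) ++
    encodeRow (fun k : I.Vertex => decide ((k : ℕ) ∈ I.approval i))).flatten ++
  [.ket]

open Classical in
/-- ARH restricted to the instances in the class `C` can be solved in polynomial time: a single
deterministic (multi-stack) Turing machine, started on the input word of any instance in `C`, halts
with the correct yes/no answer as its output after at most `p (length of the input word)` steps,
where `p` is a polynomial. -/
def SolvableInPolyTimeOn (C : ARHInstance → Prop) : Prop :=
  Nonempty (Turing.TM2ComputableInPolyTime
    (fun I : {I : ARHInstance // C I} => I.1.encode)
    Computability.encodeBool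
    (fun I => decide I.1.IsYes))

end ARHInstance

/-! Refugees are interchangeable, so a housing matters only through the set `X` of vertices that it
occupies. A dynamic program decides the vertices one at a time. Suppose that the vertices in `P`
have been decided. The inhabitant of a vertex `u` can be checked as soon as all neighbours of `u`
are in `P` (`u` is done), and afterwards the number of refugees next to `u` is irrelevant. If no
neighbour of `u` is in `P`, that number is still 0. Hence a partial solution need only be remembered
through its counts at the pending vertices, which have some but not all neighbours in `P`, and
through `X.card`. `mem_run` shows that the table holds exactly the summaries of the partial
solutions, on every graph, and with `isYes_iff` the answer read off the final table is correct.

The degree bound enters only in the size of the table. If some vertex is pending, the next vertex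
`v` is chosen adjacent to a pending `u₀`. As `u₀` has at most two neighbours, one of which is in
`P`, it becomes done. Only the neighbours of `v` other than `u₀` can become pending, so at most two
vertices are ever pending (`card_pendings_next_le`). A summary thus consists of at most three
numbers up to `n`, where `n` is the number of vertices, and duplicates are removed: the table has at
most `(n + 1) ^ 3` entries (`length_run_le`).

For the Turing machine, a small structured language on stacks is compiled to `TM2` machines. Data
are binary trees, written on a stack in prefix code. `PolyTime` is closed under composition,
pairing, case distinction and those left folds whose intermediate values stay polynomially bounded,
which suffices to express the algorithm. The table bound is what makes its main fold admissible. -/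

open Turing

/-! ### Structured stack programs and their simulation by machines -/

/-- Structured programs acting on finitely many stacks, where the stack `k` has alphabet `Γ k`. -/
inductive StackProg (K : Type) (Γ : K → Type) : Type
  | skip : StackProg K Γ
  | push (k : K) (a : Γ k) : StackProg K Γ
  | pop (k : K) : StackProg K Γ
  | seq (c d : StackProg K Γ) : StackProg K Γ
  | ite (k : K) (p : Option (Γ k) → Bool) (c d : StackProg K Γ) : StackProg K Γ
  | loop (k : K) (p : Option (Γ k) → Bool) (c : StackProg K Γ) : StackProg K Γ

namespace StackProg

variable {K : Type} {Γ : K → Type}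

/-- Program points of a structured program. -/
def Label : StackProg K Γ → Type
  | skip => Unit
  | push _ _ => Unit
  | pop _ => Unit
  | seq c d => c.Label ⊕ d.Label
  | ite _ _ c d => Option (c.Label ⊕ d.Label)
  | loop _ _ c => Option c.Label

/-- The program points of a structured program are finitely many. -/
@[reducible] def labelFintype : (c : StackProg K Γ) → Fintype c.Label
  | skip => inferInstanceAs (Fintype Unit)
  | push _ _ => inferInstanceAs (Fintype Unit)
  | pop _ => inferInstanceAs (Fintype Unit)
  | seq c d =>
    letI := c.labelFintype
    letI := d.labelFintype
    inferInstanceAs (Fintype (c.Label ⊕ d.Label))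
  | ite _ _ c d =>
    letI := c.labelFintype
    letI := d.labelFintype
    inferInstanceAs (Fintype (Option (c.Label ⊕ d.Label)))
  | loop _ _ c =>
    letI := c.labelFintype
    inferInstanceAs (Fintype (Option c.Label))

/-- The program point where a structured program starts. -/
def entry : (c : StackProg K Γ) → c.Label
  | skip => ()
  | push _ _ => ()
  | pop _ => ()
  | seq c _ => Sum.inl c.entry
  | ite _ _ _ _ => none
  | loop _ _ _ => none

/-- The machine statement at a program point, where `e` embeds the program points into the labels
of the machine, and `x` is the label to be reached in the end. -/
def stmt {Λ : Type} : (c : StackProg K Γ) → (c.Label → Λ) → Λ → c.Label → TM2.Stmt Γ Λ Bool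
  | skip, _, x, _ => .goto fun _ => x
  | push k a, _, x, _ => .push k (fun _ => a) (.goto fun _ => x)
  | pop k, _, x, _ => .pop k (fun v _ => v) (.goto fun _ => x)
  | seq c d, e, _, .inl l => c.stmt (fun l => e (.inl l)) (e (.inr d.entry)) l
  | seq _ d, e, x, .inr l => d.stmt (fun l => e (.inr l)) x l
  | ite k p c d, e, _, none =>
    .peek k (fun _ o => p o) (.branch id (.goto fun _ => e (some (.inl c.entry)))
      (.goto fun _ => e (some (.inr d.entry))))
  | ite _ _ c _, e, x, some (.inl l) => c.stmt (fun l => e (some (.inl l))) x l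
  | ite _ _ _ d, e, x, some (.inr l) => d.stmt (fun l => e (some (.inr l))) x l
  | loop k p c, e, x, none =>
    .peek k (fun _ o => p o) (.branch id (.goto fun _ => e (some c.entry)) (.goto fun _ => x))
  | loop _ _ c, e, _, some l => c.stmt (fun l => e (some l)) (e none) l

variable [DecidableEq K]

/-- `Runs c s n t`: the program `c`, started on the stacks `s`, ends with the stacks `t` after
`n` steps. -/
inductive Runs : StackProg K Γ → (∀ k, List (Γ k)) → ℕ → (∀ k, List (Γ k)) → Prop
  | skip (s) : Runs .skip s 1 s
  | push (k a s) : Runs (.push k a) s 1 (Function.update s k (a :: s k))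
  | pop (k s) : Runs (.pop k) s 1 (Function.update s k (s k).tail)
  | seq {c d s t u m n} : Runs c s m t → Runs d t n u → Runs (.seq c d) s (m + n) u
  | ite_true {k p c d s t n} : p (s k).head? = true → Runs c s n t →
      Runs (.ite k p c d) s (1 + n) t
  | ite_false {k p c d s t n} : p (s k).head? = false → Runs d s n t →
      Runs (.ite k p c d) s (1 + n) t
  | loop_false {k p c s} : p (s k).head? = false → Runs (.loop k p c) s 1 s
  | loop_true {k p c s t u m n} : p (s k).head? = true → Runs c s m t →
      Runs (.loop k p c) t n u → Runs (.loop k p c) s (1 + m + n) u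

/-- A machine that contains the statements of a structured program simulates it. -/
theorem Runs.simulate {c : StackProg K Γ} {s t : ∀ k, List (Γ k)} {n : ℕ} (h : Runs c s n t)
    {Λ : Type} (M : Λ → TM2.Stmt Γ Λ Bool) (e : c.Label → Λ) (x : Λ)
    (hM : ∀ l, M (e l) = c.stmt e x l) (v : Bool) :
    ∃ v', (flip bind (TM2.step M))^[n] (some ⟨some (e c.entry), v, s⟩) =
      some ⟨some x, v', t⟩ := by
  -- A subprogram has its own embedding and its own exit label, so these vary along with `Λ`. The
  -- flag `v` may be arbitrary since each test overwrites it before branching.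
  induction h generalizing Λ v with
  | skip s => exact ⟨v, by simp [flip, TM2.step, hM, stmt, TM2.stepAux]⟩
  | push k a s => exact ⟨v, by simp [flip, TM2.step, hM, stmt, TM2.stepAux]⟩
  | pop k s => exact ⟨v, by simp [flip, TM2.step, hM, stmt, TM2.stepAux]⟩
  | @seq c d s t u m n _ _ ih₁ ih₂ =>
    obtain ⟨v₁, h₁⟩ := ih₁ M (fun l => e (.inl l)) (e (.inr d.entry)) (fun l => hM (.inl l)) v
    obtain ⟨v₂, h₂⟩ := ih₂ M (fun l => e (.inr l)) x (fun l => hM (.inr l)) v₁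
    refine ⟨v₂, ?_⟩
    rw [add_comm, Function.iterate_add_apply]
    exact (congrArg _ h₁).trans h₂
  | @ite_true k p c d s t n hp _ ih =>
    obtain ⟨v₁, h₁⟩ := ih M (fun l => e (some (.inl l))) x (fun l => hM (some (.inl l))) true
    refine ⟨v₁, ?_⟩
    rw [add_comm, Function.iterate_add_apply, ← h₁]
    have h₀ := hM none
    simp only [stmt] at h₀
    simp [flip, TM2.step, entry, h₀, TM2.stepAux, hp]
  | @ite_false k p c d s t n hp _ ih =>
    obtain ⟨v₁, h₁⟩ := ih M (fun l => e (some (.inr l))) x (fun l => hM (some (.inr l))) false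
    refine ⟨v₁, ?_⟩
    rw [add_comm, Function.iterate_add_apply, ← h₁]
    have h₀ := hM none
    simp only [stmt] at h₀
    simp [flip, TM2.step, entry, h₀, TM2.stepAux, hp]
  | @loop_false k p c s hp =>
    have h₀ := hM none
    simp only [stmt] at h₀
    exact ⟨false, by simp [flip, TM2.step, entry, h₀, TM2.stepAux, hp]⟩
  | @loop_true k p c s t u m n hp _ _ ih₁ ih₂ =>
    obtain ⟨v₁, h₁⟩ := ih₁ M (fun l => e (some l)) (e none) (fun l => hM (some l)) true
    obtain ⟨v₂, h₂⟩ := ih₂ M e x hM v₁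
    refine ⟨v₂, ?_⟩
    rw [add_comm, Function.iterate_add_apply, add_comm 1, Function.iterate_add_apply, ← h₂]
    congr 1
    refine Eq.trans ?_ h₁
    congr 1
    have h₀ := hM none
    simp only [stmt] at h₀
    simp [flip, TM2.step, entry, h₀, TM2.stepAux, hp]

/-- The machine of a structured program, with input stack `k₀` and output stack `k₁`. -/
def toFinTM2 [Fintype K] (k₀ k₁ : K) [Fintype (Γ k₀)] (c : StackProg K Γ) : FinTM2 :=
  letI := c.labelFintype
  { K := K
    k₀ := k₀
    k₁ := k₁
    Γ := Γ
    Λ := Option c.Label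
    main := some c.entry
    σ := Bool
    initialState := false
    -- The label `none` is the exit. It resets the flag, because the final configuration has to
    -- carry the initial state, and this costs one further step.
    m := fun l => l.elim (.load (fun _ => false) .halt) (c.stmt some none) }

theorem Runs.toFinTM2 [Fintype K] {k₀ k₁ : K} [Fintype (Γ k₀)] {c : StackProg K Γ}
    {s t : ∀ k, List (Γ k)} {n : ℕ} (h : Runs c s n t) :
    (flip bind (c.toFinTM2 k₀ k₁).step)^[n + 1]
      (some (⟨some (some c.entry), false, s⟩ : TM2.Cfg Γ (Option c.Label) Bool)) =
      some (⟨none, false, t⟩ : TM2.Cfg Γ (Option c.Label) Bool) := by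
  obtain ⟨v, hv⟩ := h.simulate (c.toFinTM2 k₀ k₁).m some none (fun _ => rfl) false
  rw [add_comm, Function.iterate_add_apply]
  exact (congrArg _ hv).trans rfl

end StackProg

/-! ### Binary trees in prefix code and programs that move them between stacks -/

/-- Unlabelled binary trees. -/
inductive BinTree
  | nil : BinTree
  | node (l r : BinTree) : BinTree

/-- The prefix code of a binary tree. -/
def BinTree.code : BinTree → List Bool
  | nil => [false]
  | node l r => true :: (l.code ++ r.code)

/-- The stacks of a machine working on binary trees: an input stack, a main stack that holds codes
of binary trees, two auxiliary stacks, and a counter. -/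
inductive TreeReg
  | inp | main | fst | snd | cnt
  deriving DecidableEq

instance : Fintype TreeReg :=
  ⟨{.inp, .main, .fst, .snd, .cnt}, fun k => by cases k <;> simp⟩

/-- The alphabets of the stacks. -/
abbrev TreeReg.Alphabet : TreeReg → Type
  | inp => Computability.Γ'
  | _ => Bool

/-- Structured programs for machines working on binary trees. -/
abbrev TreeProg : Type := StackProg TreeReg TreeReg.Alphabet

namespace TreeProg

/-- The memory with given contents of the stacks. -/
def mem (i : List Computability.Γ') (s a b c : List Bool) : ∀ k : TreeReg, List k.Alphabet
  | .inp => i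
  | .main => s
  | .fst => a
  | .snd => b
  | .cnt => c

section mem

variable (i i' : List Computability.Γ') (s a b c x : List Bool)

theorem update_inp : Function.update (mem i s a b c) .inp i' = mem i' s a b c := by
  funext k; cases k <;> rfl

theorem update_main : Function.update (mem i s a b c) .main x = mem i x a b c := by
  funext k; cases k <;> rfl

theorem update_fst : Function.update (mem i s a b c) .fst x = mem i s x b c := by
  funext k; cases k <;> rfl

theorem update_snd : Function.update (mem i s a b c) .snd x = mem i s a x c := by
  funext k; cases k <;> rfl

theorem update_cnt : Function.update (mem i s a b c) .cnt x = mem i s a b x := by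
  funext k; cases k <;> rfl

end mem

/-- The program `c`, started on the stacks `s`, ends with the stacks `t` after at most `N`
steps. -/
def RunsIn (c : TreeProg) (s : ∀ k : TreeReg, List k.Alphabet) (N : ℕ)
    (t : ∀ k : TreeReg, List k.Alphabet) : Prop :=
  ∃ n ≤ N, c.Runs s n t

namespace RunsIn

variable {c d : TreeProg} {s t u : ∀ k : TreeReg, List k.Alphabet} {m n N : ℕ}

theorem mono (h : RunsIn c s n t) (hn : n ≤ N) : RunsIn c s N t :=
  let ⟨k, hk, hr⟩ := h
  ⟨k, hk.trans hn, hr⟩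

theorem skip : RunsIn .skip s 1 s := ⟨1, le_rfl, .skip s⟩

theorem seq (h₁ : RunsIn c s m t) (h₂ : RunsIn d t n u) : RunsIn (.seq c d) s (m + n) u :=
  let ⟨_, hk₁, hr₁⟩ := h₁
  let ⟨_, hk₂, hr₂⟩ := h₂
  ⟨_, add_le_add hk₁ hk₂, .seq hr₁ hr₂⟩

theorem ite_true {k : TreeReg} {p : Option k.Alphabet → Bool} (hp : p (s k).head? = true)
    (h : RunsIn c s n t) : RunsIn (.ite k p c d) s (n + 1) t :=
  let ⟨_, hk, hr⟩ := h
  ⟨_, by rw [add_comm]; gcongr, .ite_true hp hr⟩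

theorem ite_false {k : TreeReg} {p : Option k.Alphabet → Bool} (hp : p (s k).head? = false)
    (h : RunsIn d s n t) : RunsIn (.ite k p c d) s (n + 1) t :=
  let ⟨_, hk, hr⟩ := h
  ⟨_, by rw [add_comm]; gcongr, .ite_false hp hr⟩

theorem loop_false {k : TreeReg} {p : Option k.Alphabet → Bool} (hp : p (s k).head? = false) :
    RunsIn (.loop k p c) s 1 s :=
  ⟨1, le_rfl, .loop_false hp⟩

theorem loop_true {k : TreeReg} {p : Option k.Alphabet → Bool} (hp : p (s k).head? = true)
    (h₁ : RunsIn c s m t) (h₂ : RunsIn (.loop k p c) t n u) :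
    RunsIn (.loop k p c) s (1 + m + n) u :=
  let ⟨_, hk₁, hr₁⟩ := h₁
  let ⟨_, hk₂, hr₂⟩ := h₂
  ⟨_, by gcongr, .loop_true hp hr₁ hr₂⟩

end RunsIn

section basic

variable (i : List Computability.Γ') (s a b c : List Bool) (x : Bool) (y : Computability.Γ')

theorem runsIn_push_main :
    RunsIn (.push .main x) (mem i s a b c) 1 (mem i (x :: s) a b c) :=
  ⟨1, le_rfl, by
    have h := StackProg.Runs.push (Γ := TreeReg.Alphabet) .main x (mem i s a b c)
    rwa [update_main] at h⟩

theorem runsIn_push_fst :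
    RunsIn (.push .fst x) (mem i s a b c) 1 (mem i s (x :: a) b c) :=
  ⟨1, le_rfl, by
    have h := StackProg.Runs.push (Γ := TreeReg.Alphabet) .fst x (mem i s a b c)
    rwa [update_fst] at h⟩

theorem runsIn_push_snd :
    RunsIn (.push .snd x) (mem i s a b c) 1 (mem i s a (x :: b) c) :=
  ⟨1, le_rfl, by
    have h := StackProg.Runs.push (Γ := TreeReg.Alphabet) .snd x (mem i s a b c)
    rwa [update_snd] at h⟩

theorem runsIn_push_cnt :
    RunsIn (.push .cnt x) (mem i s a b c) 1 (mem i s a b (x :: c)) :=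
  ⟨1, le_rfl, by
    have h := StackProg.Runs.push (Γ := TreeReg.Alphabet) .cnt x (mem i s a b c)
    rwa [update_cnt] at h⟩

theorem runsIn_pop_inp :
    RunsIn (.pop .inp) (mem (y :: i) s a b c) 1 (mem i s a b c) :=
  ⟨1, le_rfl, by rw [← update_inp (y :: i) i]; exact .pop _ _⟩

theorem runsIn_pop_main :
    RunsIn (.pop .main) (mem i (x :: s) a b c) 1 (mem i s a b c) :=
  ⟨1, le_rfl, by rw [← update_main i (x :: s) a b c s]; exact .pop _ _⟩

theorem runsIn_pop_fst :
    RunsIn (.pop .fst) (mem i s (x :: a) b c) 1 (mem i s a b c) :=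
  ⟨1, le_rfl, by rw [← update_fst i s (x :: a) b c a]; exact .pop _ _⟩

theorem runsIn_pop_snd :
    RunsIn (.pop .snd) (mem i s a (x :: b) c) 1 (mem i s a b c) :=
  ⟨1, le_rfl, by rw [← update_snd i s a (x :: b) c b]; exact .pop _ _⟩

theorem runsIn_pop_cnt :
    RunsIn (.pop .cnt) (mem i s a b (x :: c)) 1 (mem i s a b c) :=
  ⟨1, le_rfl, by rw [← update_cnt i s a b (x :: c) c]; exact .pop _ _⟩

end basic

/-- Is the top symbol `true`? -/
def isTrue (o : Option Bool) : Bool := o == some true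

/-- Remove a tree from the main stack, and process every symbol of its code by `put`. -/
def walk (put : Bool → TreeProg) : TreeProg :=
  .seq (.push .cnt true) <| .loop .cnt isTrue <|
    .ite .main isTrue (.seq (put true) (.seq (.push .cnt true) (.pop .main)))
      (.seq (put false) (.seq (.pop .cnt) (.pop .main)))

/-- The counter holds one token for each subtree still to be read: an inner node replaces one
subtree by two, a leaf completes one. So the token on top of `c` is used up exactly when `t` has
been consumed, without any end marker. The run `h` of the remaining loop is a hypothesis so that the
induction can chain the two subtrees of a node. Each symbol costs six steps: two tests, two for
`put`, one for the counter, one for the removal. -/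
theorem runsIn_walk_loop {put : Bool → TreeProg} {f g : Bool → List Bool → List Bool}
    (hput : ∀ x s a b c, RunsIn (put x) (mem [] s a b c) 2 (mem [] s (f x a) (g x b) c))
    (t : BinTree) {s a b c : List Bool} {N : ℕ} {u : ∀ k : TreeReg, List k.Alphabet}
    (h : RunsIn (.loop .cnt isTrue <|
      .ite .main isTrue (.seq (put true) (.seq (.push .cnt true) (.pop .main)))
        (.seq (put false) (.seq (.pop .cnt) (.pop .main))))
      (mem [] s (t.code.foldl (fun l x => f x l) a) (t.code.foldl (fun l x => g x l) b) c) N u) :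
    RunsIn (.loop .cnt isTrue <|
      .ite .main isTrue (.seq (put true) (.seq (.push .cnt true) (.pop .main)))
        (.seq (put false) (.seq (.pop .cnt) (.pop .main))))
      (mem [] (t.code ++ s) a b (true :: c)) (6 * t.code.length + N) u := by
  induction t generalizing s a b c N with
  | nil =>
    refine (RunsIn.loop_true rfl (.ite_false rfl (.seq (hput _ _ _ _ _)
      (.seq (runsIn_pop_cnt ..) (runsIn_pop_main ..)))) h).mono ?_
    simp [BinTree.code]
  | node l r ihl ihr =>
    simp only [BinTree.code, List.foldl_cons, List.foldl_append] at h
    have := ihl (ihr h)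
    simp only [BinTree.code, List.cons_append, List.append_assoc]
    refine (RunsIn.loop_true rfl (.ite_true rfl (.seq (hput _ _ _ _ _)
      (.seq (runsIn_push_cnt ..) (runsIn_pop_main ..)))) this).mono ?_
    simp only [List.length_cons, List.length_append]
    omega

theorem runsIn_walk {put : Bool → TreeProg} {f g : Bool → List Bool → List Bool}
    (hput : ∀ x s a b c, RunsIn (put x) (mem [] s a b c) 2 (mem [] s (f x a) (g x b) c))
    (t : BinTree) (s a b : List Bool) :
    RunsIn (walk put) (mem [] (t.code ++ s) a b []) (6 * t.code.length + 2)
      (mem [] s (t.code.foldl (fun l x => f x l) a) (t.code.foldl (fun l x => g x l) b) []) :=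
  (RunsIn.seq (runsIn_push_cnt ..) (runsIn_walk_loop hput t (.loop_false rfl))).mono (by omega)

/-- Remove a tree from the main stack. -/
def drop : TreeProg := walk fun _ => .skip

theorem runsIn_drop (t : BinTree) (s a b : List Bool) :
    RunsIn drop (mem [] (t.code ++ s) a b []) (6 * t.code.length + 2) (mem [] s a b []) := by
  have := runsIn_walk (put := fun _ => .skip) (f := fun _ l => l) (g := fun _ l => l)
    (fun x s a b c => RunsIn.skip.mono (by norm_num)) t s a b
  simpa [drop] using this

/-- Move a tree from the main stack to the first auxiliary stack. -/
def toFst : TreeProg := walk fun x => .push .fst x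

theorem runsIn_toFst (t : BinTree) (s a b : List Bool) :
    RunsIn toFst (mem [] (t.code ++ s) a b []) (6 * t.code.length + 2)
      (mem [] s (t.code.reverse ++ a) b []) := by
  have := runsIn_walk (put := fun x => .push .fst x) (f := fun x l => x :: l) (g := fun _ l => l)
    (fun x s a b c => (runsIn_push_fst ..).mono (by norm_num)) t s a b
  simpa [toFst] using this

/-- Move a tree from the main stack to the second auxiliary stack. -/
def toSnd : TreeProg := walk fun x => .push .snd x

theorem runsIn_toSnd (t : BinTree) (s a b : List Bool) :
    RunsIn toSnd (mem [] (t.code ++ s) a b []) (6 * t.code.length + 2)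
      (mem [] s a (t.code.reverse ++ b) []) := by
  have := runsIn_walk (put := fun x => .push .snd x) (f := fun _ l => l) (g := fun x l => x :: l)
    (fun x s a b c => (runsIn_push_snd ..).mono (by norm_num)) t s a b
  simpa [toSnd] using this

/-- Move a tree from the main stack to both auxiliary stacks. -/
def toBoth : TreeProg := walk fun x => .seq (.push .fst x) (.push .snd x)

theorem runsIn_toBoth (t : BinTree) (s a b : List Bool) :
    RunsIn toBoth (mem [] (t.code ++ s) a b []) (6 * t.code.length + 2)
      (mem [] s (t.code.reverse ++ a) (t.code.reverse ++ b) []) := by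
  have := runsIn_walk (put := fun x => .seq (.push .fst x) (.push .snd x))
    (f := fun x l => x :: l) (g := fun x l => x :: l)
    (fun x s a b c => .seq (runsIn_push_fst ..) (runsIn_push_snd ..)) t s a b
  simpa [toBoth] using this

/-- Move the contents of the first auxiliary stack to the main stack. -/
def ofFst : TreeProg :=
  .loop .fst Option.isSome <|
    .seq (.ite .fst isTrue (.push .main true) (.push .main false)) (.pop .fst)

theorem runsIn_ofFst (s a b : List Bool) :
    RunsIn ofFst (mem [] s a b []) (4 * a.length + 1) (mem [] (a.reverse ++ s) [] b []) := by
  induction a generalizing s with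
  | nil => exact .loop_false rfl
  | cons x a ih =>
    have h : RunsIn (.ite .fst isTrue (.push .main true) (.push .main false))
        (mem [] s (x :: a) b []) 2 (mem [] (x :: s) (x :: a) b []) := by
      cases x
      · exact .ite_false rfl (runsIn_push_main ..)
      · exact .ite_true rfl (runsIn_push_main ..)
    have := RunsIn.loop_true rfl (.seq h (runsIn_pop_fst ..)) (ih (x :: s))
    simp only [List.reverse_cons, List.append_assoc, List.singleton_append]
    exact this.mono (by simp; omega)

/-- Move the contents of the second auxiliary stack to the main stack. -/
def ofSnd : TreeProg :=
  .loop .snd Option.isSome <|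
    .seq (.ite .snd isTrue (.push .main true) (.push .main false)) (.pop .snd)

theorem runsIn_ofSnd (s a b : List Bool) :
    RunsIn ofSnd (mem [] s a b []) (4 * b.length + 1) (mem [] (b.reverse ++ s) a [] []) := by
  induction b generalizing s with
  | nil => exact .loop_false rfl
  | cons x b ih =>
    have h : RunsIn (.ite .snd isTrue (.push .main true) (.push .main false))
        (mem [] s a (x :: b) []) 2 (mem [] (x :: s) a (x :: b) []) := by
      cases x
      · exact .ite_false rfl (runsIn_push_main ..)
      · exact .ite_true rfl (runsIn_push_main ..)
    have := RunsIn.loop_true rfl (.seq h (runsIn_pop_snd ..)) (ih (x :: s))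
    simp only [List.reverse_cons, List.append_assoc, List.singleton_append]
    exact this.mono (by simp; omega)

/-- The memory whose main stack holds `s`, while all other stacks are empty. -/
def stack (s : List Bool) : ∀ k : TreeReg, List k.Alphabet := mem [] s [] [] []

/-- Duplicate the tree on top of the main stack. -/
def dup : TreeProg := .seq toBoth (.seq ofFst ofSnd)

theorem runsIn_dup (t : BinTree) (s : List Bool) :
    RunsIn dup (stack (t.code ++ s)) (14 * t.code.length + 4)
      (stack (t.code ++ (t.code ++ s))) := by
  have := RunsIn.seq (runsIn_toBoth t s [] []) (.seq (runsIn_ofFst ..) (runsIn_ofSnd ..))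
  simp only [List.append_nil, List.reverse_reverse, List.length_reverse] at this
  exact this.mono (by omega)

/-- Swap the two trees on top of the main stack. -/
def swap : TreeProg := .seq toFst (.seq toSnd (.seq ofFst ofSnd))

theorem runsIn_swap (t u : BinTree) (s : List Bool) :
    RunsIn swap (stack (t.code ++ (u.code ++ s))) (10 * t.code.length + 10 * u.code.length + 6)
      (stack (u.code ++ (t.code ++ s))) := by
  have := RunsIn.seq (runsIn_toFst t (u.code ++ s) [] []) (.seq (runsIn_toSnd ..)
    (.seq (runsIn_ofFst ..) (runsIn_ofSnd ..)))
  simp only [List.append_nil, List.reverse_reverse, List.length_reverse] at this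
  exact this.mono (by omega)

/-- Replace a tree on top of the main stack by its left subtree. -/
def left : TreeProg := .seq (.pop .main) (.seq toFst (.seq drop ofFst))

theorem runsIn_left (t u : BinTree) (s : List Bool) :
    RunsIn left (stack ((t.node u).code ++ s)) (10 * (t.node u).code.length + 6)
      (stack (t.code ++ s)) := by
  have := RunsIn.seq (runsIn_pop_main [] (t.code ++ (u.code ++ s)) [] [] [] true)
    (.seq (runsIn_toFst ..) (.seq (runsIn_drop ..) (runsIn_ofFst ..)))
  simp only [List.append_nil, List.reverse_reverse, List.length_reverse] at this
  simp only [BinTree.code, List.cons_append, List.append_assoc, stack]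
  exact this.mono (by simp; omega)

/-- Replace a tree on top of the main stack by its right subtree. -/
def right : TreeProg := .seq (.pop .main) drop

theorem runsIn_right (t u : BinTree) (s : List Bool) :
    RunsIn right (stack ((t.node u).code ++ s)) (6 * (t.node u).code.length + 3)
      (stack (u.code ++ s)) := by
  have := RunsIn.seq (runsIn_pop_main [] (t.code ++ (u.code ++ s)) [] [] [] true)
    (runsIn_drop ..)
  simp only [BinTree.code, List.cons_append, List.append_assoc, stack]
  exact this.mono (by simp; omega)

/-- Push a list on the main stack, the last element first. -/
def pushAll : List Bool → TreeProg
  | [] => .skip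
  | x :: l => .seq (pushAll l) (.push .main x)

theorem runsIn_pushAll (l s : List Bool) :
    RunsIn (pushAll l) (stack s) (l.length + 1) (stack (l ++ s)) := by
  induction l with
  | nil => exact .skip
  | cons x l ih => exact (RunsIn.seq ih (runsIn_push_main ..)).mono (by simp)

end TreeProg

/-! ### Tree encodings, polynomial bounds and polynomial-time functions -/

/-- A representation of the elements of a type by binary trees. -/
class TreeEncoding (α : Type*) where
  /-- The binary tree that represents an element. -/
  enc : α → BinTree

open TreeEncoding (enc)

namespace TreeEncoding

instance : TreeEncoding Unit := ⟨fun _ => .nil⟩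

instance : TreeEncoding Bool := ⟨fun b => if b then .node .nil .nil else .nil⟩

instance : TreeEncoding ℕ := ⟨Nat.rec .nil fun _ t => .node .nil t⟩

instance {α β : Type*} [TreeEncoding α] [TreeEncoding β] : TreeEncoding (α × β) :=
  ⟨fun p => .node (enc p.1) (enc p.2)⟩

instance {α : Type*} [TreeEncoding α] : TreeEncoding (List α) :=
  ⟨List.rec .nil fun a _ t => .node (enc a) t⟩

/-- With unchanged codes, `PolyTime` on a subtype asks for correctness and time bounds only on
arguments satisfying `p`. This is how branches of a case distinction and the restriction on the
degree are expressed. -/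
instance {α : Type*} [TreeEncoding α] (p : α → Prop) : TreeEncoding (Subtype p) :=
  ⟨fun a => enc a.1⟩

end TreeEncoding

/-- The length of the code of an element. -/
def treeSize {α : Type*} [TreeEncoding α] (a : α) : ℕ := (enc a).code.length

section treeSize

variable {α β : Type*} [TreeEncoding α] [TreeEncoding β]

@[simp] theorem treeSize_prod (p : α × β) : treeSize p = treeSize p.1 + treeSize p.2 + 1 := by
  simp [treeSize, enc, BinTree.code]

@[simp] theorem treeSize_nil : treeSize ([] : List α) = 1 := by
  simp [treeSize, enc, BinTree.code]

@[simp] theorem treeSize_cons (a : α) (l : List α) :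
    treeSize (a :: l) = treeSize a + treeSize l + 1 := by
  simp [treeSize, enc, BinTree.code]

@[simp] theorem treeSize_succ (n : ℕ) : treeSize (n + 1) = treeSize n + 2 := by
  simp [treeSize, enc, BinTree.code]

theorem treeSize_nat (n : ℕ) : treeSize n = 2 * n + 1 := by
  induction n with
  | zero => rfl
  | succ n ih => rw [treeSize_succ, ih]; ring

theorem treeSize_bool_le (b : Bool) : treeSize b ≤ 3 := by cases b <;> decide

@[simp] theorem treeSize_append (l₁ l₂ : List α) :
    treeSize (l₁ ++ l₂) + 1 = treeSize l₁ + treeSize l₂ := by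
  induction l₁ with
  | nil => simp; omega
  | cons a l ih => simp; omega

theorem treeSize_le_of_mem {a : α} {l : List α} (h : a ∈ l) : treeSize a ≤ treeSize l := by
  induction h with
  | head l => simp; omega
  | tail b _ ih => simp; omega

theorem length_le_treeSize (l : List α) : l.length ≤ treeSize l := by
  induction l with
  | nil => simp
  | cons a l ih => simp; omega

theorem treeSize_le_length_mul (l : List α) (N : ℕ) (h : ∀ a ∈ l, treeSize a ≤ N) :
    treeSize l ≤ l.length * (N + 1) + 1 := by
  induction l with
  | nil => simp
  | cons a l ih =>
    have := ih fun b hb => h b (List.mem_cons_of_mem a hb)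
    have := h a List.mem_cons_self
    simp [add_mul]; omega

end treeSize

/-- A function is polynomially bounded in the length of the code of its argument. -/
def PolyBounded {α : Type*} [TreeEncoding α] (t : α → ℕ) : Prop :=
  ∃ k, ∀ a, t a ≤ (treeSize a + 2) ^ k

namespace PolyBounded

variable {α β : Type*} [TreeEncoding α] [TreeEncoding β] {t u : α → ℕ}

theorem of_le (hu : PolyBounded u) (h : ∀ a, t a ≤ u a) : PolyBounded t :=
  let ⟨k, hk⟩ := hu
  ⟨k, fun a => (h a).trans (hk a)⟩

theorem size : PolyBounded (treeSize : α → ℕ) := ⟨1, fun a => by simp⟩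

theorem const (n : ℕ) : PolyBounded fun _ : α => n :=
  ⟨n, fun a => Nat.lt_two_pow_self.le.trans (Nat.pow_le_pow_left (by omega) n)⟩

theorem add (ht : PolyBounded t) (hu : PolyBounded u) : PolyBounded fun a => t a + u a := by
  obtain ⟨k, hk⟩ := ht
  obtain ⟨m, hm⟩ := hu
  refine ⟨k + m + 1, fun a => ?_⟩
  have h₁ : (treeSize a + 2) ^ k ≤ (treeSize a + 2) ^ (k + m) :=
    Nat.pow_le_pow_right (by omega) (by omega)
  have h₂ : (treeSize a + 2) ^ m ≤ (treeSize a + 2) ^ (k + m) :=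
    Nat.pow_le_pow_right (by omega) (by omega)
  -- The base is at least 2, so one more factor absorbs the 2.
  calc t a + u a ≤ (treeSize a + 2) ^ (k + m) * 2 := by have := hk a; have := hm a; omega
    _ ≤ (treeSize a + 2) ^ (k + m + 1) := by rw [pow_succ]; gcongr; omega

theorem mul (ht : PolyBounded t) (hu : PolyBounded u) : PolyBounded fun a => t a * u a := by
  obtain ⟨k, hk⟩ := ht
  obtain ⟨m, hm⟩ := hu
  exact ⟨k + m, fun a => by rw [pow_add]; exact Nat.mul_le_mul (hk a) (hm a)⟩

theorem pow (ht : PolyBounded t) (n : ℕ) : PolyBounded fun a => t a ^ n := by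
  obtain ⟨k, hk⟩ := ht
  exact ⟨k * n, fun a => by rw [pow_mul]; exact Nat.pow_le_pow_left (hk a) n⟩

theorem comp {t : β → ℕ} {f : α → β} (ht : PolyBounded t)
    (hf : PolyBounded fun a => treeSize (f a)) : PolyBounded fun a => t (f a) := by
  obtain ⟨k, hk⟩ := ht
  exact ((hf.add (const 2)).pow k).of_le fun a => hk _

end PolyBounded

/-- A function is computed in polynomial time by a structured program that replaces the code of
the argument on top of the main stack by the code of the value. -/
def PolyTime {α β : Type*} [TreeEncoding α] [TreeEncoding β] (f : α → β) : Prop :=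
  PolyBounded (fun a => treeSize (f a)) ∧ ∃ (c : TreeProg) (t : α → ℕ), PolyBounded t ∧
    ∀ a s, c.RunsIn (TreeProg.stack ((enc a).code ++ s)) (t a)
      (TreeProg.stack ((enc (f a)).code ++ s))

namespace PolyTime

open TreeProg

variable {α β γ δ σ : Type*} [TreeEncoding α] [TreeEncoding β] [TreeEncoding γ] [TreeEncoding δ]
  [TreeEncoding σ]

theorem bounded {f : α → β} (hf : PolyTime f) : PolyBounded fun a => treeSize (f a) := hf.1

theorem of_enc {f g : α → β} (hf : PolyTime f) (h : ∀ a, enc (g a) = enc (f a)) : PolyTime g := by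
  obtain ⟨hb, c, t, ht, hc⟩ := hf
  refine ⟨by simpa only [treeSize, h] using hb, c, t, ht, fun a s => ?_⟩
  rw [h]; exact hc a s

/-- Programs see codes only, so the same program serves for values of another type with equal codes,
such as numbers and lists of units. -/
theorem of_enc' {f : α → β} {g : α → γ} (hf : PolyTime f) (h : ∀ a, enc (g a) = enc (f a)) :
    PolyTime g := by
  obtain ⟨hb, c, t, ht, hc⟩ := hf
  refine ⟨by simpa only [treeSize, h] using hb, c, t, ht, fun a s => ?_⟩
  rw [h]; exact hc a s

theorem of_enc_eq {f : α → β} (h : ∀ a, enc (f a) = enc a) : PolyTime f :=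
  ⟨PolyBounded.size.of_le fun a => by rw [treeSize, h]; rfl, .skip, fun _ => 1, .const 1,
    fun a s => by rw [h]; exact .skip⟩

theorem id : PolyTime fun a : α => a := of_enc_eq fun _ => rfl

theorem const (b : β) : PolyTime fun _ : α => b :=
  ⟨.const _, .seq drop (pushAll (enc b).code), _,
    (((PolyBounded.const 6).mul .size).add (.const 2)).add (.const _), fun a s =>
      .seq (runsIn_drop (enc a) s [] []) (runsIn_pushAll _ _)⟩

theorem comp {g : β → γ} {f : α → β} (hg : PolyTime g) (hf : PolyTime f) :
    PolyTime fun a => g (f a) := by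
  obtain ⟨hgb, c, t, ht, hc⟩ := hg
  obtain ⟨hfb, d, u, hu, hd⟩ := hf
  exact ⟨hgb.comp hfb, .seq d c, _, hu.add (ht.comp hfb), fun a s => .seq (hd a s) (hc _ s)⟩

theorem fst : PolyTime fun p : α × β => p.1 :=
  ⟨PolyBounded.size.of_le fun p => by simp; omega, left, _,
    ((PolyBounded.const 10).mul .size).add (.const 6), fun _ _ => runsIn_left _ _ _⟩

theorem snd : PolyTime fun p : α × β => p.2 :=
  ⟨PolyBounded.size.of_le fun p => by simp; omega, right, _,
    ((PolyBounded.const 6).mul .size).add (.const 3), fun _ _ => runsIn_right _ _ _⟩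

/-- From the top, the stack passes through `a, a`, then `g a, a`, then `a, g a`, then `f a, g a`. A
final `true` joins the two codes into the code of the pair. -/
theorem pair {f : α → β} {g : α → γ} (hf : PolyTime f) (hg : PolyTime g) :
    PolyTime fun a => (f a, g a) := by
  obtain ⟨hfb, c, t, ht, hc⟩ := hf
  obtain ⟨hgb, d, u, hu, hd⟩ := hg
  refine ⟨((hfb.add hgb).add (.const 1)).of_le fun a => by simp,
    .seq dup (.seq d (.seq swap (.seq c (.push .main true)))), _,
    (((PolyBounded.const 14).mul .size).add (.const 4)).add
    (hu.add (((((PolyBounded.const 10).mul hgb).add ((PolyBounded.const 10).mul .size)).add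
      (.const 6)).add (ht.add (.const 1)))), fun a s => ?_⟩
  have := RunsIn.seq (runsIn_dup (enc a) s) (.seq (hd a _) (.seq (runsIn_swap _ _ _)
    (.seq (hc a _) (runsIn_push_main (x := true) ..))))
  simpa [enc, BinTree.code, treeSize, stack] using this

/-- Definition by cases, where each branch has to be computed only where it is used. -/
theorem cond' {c : α → Bool} {f g : α → β} (hc : PolyTime c)
    (hf : PolyTime fun a : {a // c a = true} => f a)
    (hg : PolyTime fun a : {a // c a = false} => g a) :
    PolyTime fun a => bif c a then f a else g a := by
  obtain ⟨-, c₀, t₀, ht₀, hc₀⟩ := hc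
  obtain ⟨⟨k₁, hk₁⟩, c₁, t₁, ⟨m₁, hm₁⟩, hc₁⟩ := hf
  obtain ⟨⟨k₂, hk₂⟩, c₂, t₂, ⟨m₂, hm₂⟩, hc₂⟩ := hg
  have hp (k : ℕ) : PolyBounded fun a : α => (treeSize a + 2) ^ k := ⟨k, fun _ => le_rfl⟩
  refine ⟨((hp k₁).add (hp k₂)).of_le fun a => ?_,
    .seq dup (.seq c₀ (.ite .main isTrue (.seq drop c₁) (.seq drop c₂))), _,
    (((PolyBounded.const 14).mul .size).add (.const 4)).add
    (ht₀.add (((PolyBounded.const 20).add ((hp m₁).add (hp m₂))).add (.const 1))), fun a s => ?_⟩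
  · cases h : c a
    · simp only [h, cond_false]
      exact (hk₂ ⟨a, h⟩).trans (Nat.le_add_left _ _)
    · simp only [h, cond_true]
      exact (hk₁ ⟨a, h⟩).trans (Nat.le_add_right _ _)
  · refine .seq (runsIn_dup (enc a) s) (.seq (hc₀ a _) ?_)
    cases h : c a
    · have h₁ : c₂.RunsIn (stack ((enc a).code ++ s)) ((treeSize a + 2) ^ m₂)
          (stack ((enc (bif c a then f a else g a)).code ++ s)) := by
        rw [h]; exact (hc₂ ⟨a, h⟩ s).mono (hm₂ ⟨a, h⟩)
      refine .ite_false rfl (.mono (.seq (runsIn_drop (enc false) _ [] []) h₁) ?_)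
      simp [enc, BinTree.code, treeSize]; omega
    · have h₁ : c₁.RunsIn (stack ((enc a).code ++ s)) ((treeSize a + 2) ^ m₁)
          (stack ((enc (bif c a then f a else g a)).code ++ s)) := by
        rw [h]; exact (hc₁ ⟨a, h⟩ s).mono (hm₁ ⟨a, h⟩)
      refine .ite_true rfl (.mono (.seq (runsIn_drop (enc true) _ [] []) h₁) ?_)
      simp [enc, BinTree.code, treeSize]

theorem val (p : α → Prop) : PolyTime fun a : Subtype p => a.1 := of_enc_eq fun _ => rfl

theorem cond {c : α → Bool} {f g : α → β} (hc : PolyTime c) (hf : PolyTime f) (hg : PolyTime g) :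
    PolyTime fun a => bif c a then f a else g a :=
  cond' hc (hf.comp (val _)) (hg.comp (val _))

theorem isEmpty : PolyTime (List.isEmpty : List α → Bool) := by
  refine ⟨(PolyBounded.const 3).of_le fun _ => treeSize_bool_le _,
    .ite .main isTrue (.seq drop (pushAll (enc false).code))
      (.seq drop (pushAll (enc true).code)), _,
    ((((PolyBounded.const 6).mul .size).add (.const 2)).add (.const 4)).add (.const 1),
    fun l s => ?_⟩
  cases l with
  | nil => exact .ite_false rfl (.mono (.seq (runsIn_drop _ _ _ _) (runsIn_pushAll _ _)) le_rfl)
  | cons a l =>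
    exact .ite_true rfl (.mono (.seq (runsIn_drop (enc (a :: l)) _ _ _) (runsIn_pushAll _ _))
      (by simp [enc, BinTree.code, treeSize]))

theorem cons {f : α → β} {g : α → List β} (hf : PolyTime f) (hg : PolyTime g) :
    PolyTime fun a => f a :: g a :=
  (of_enc_eq (f := fun p : β × List β => p.1 :: p.2) fun _ => rfl).comp (hf.pair hg)

/-- A nonempty list has the same code as the pair of its head and tail, so taking it apart costs
nothing. This holds on nonempty lists only, which is why `cond'` with its restricted branches is
needed. -/
theorem list_casesOn {f : α → List β} {g : α → γ} {h : α → β → List β → γ} (hf : PolyTime f)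
    (hg : PolyTime g) (hh : PolyTime fun p : α × β × List β => h p.1 p.2.1 p.2.2) :
    PolyTime fun a => (f a).casesOn (motive := fun _ => γ) (g a) (h a) := by
  have key : PolyTime fun a : {a // (f a).isEmpty = false} =>
      ((f a.1).casesOn (motive := fun _ => γ) (g a.1) (h a.1) : γ) := by
    have h₁ : PolyTime fun a : {a // (f a).isEmpty = false} =>
        (a.1, (f a.1).head (by simpa using a.2), (f a.1).tail) := by
      refine (val _).pair ((hf.comp (val _) |> fun h =>
        (of_enc_eq (f := fun l : {l : List β // l ≠ []} => (l.1.head l.2, l.1.tail)) ?_).comp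
          (f := fun a : {a // (f a).isEmpty = false} =>
            (⟨f a.1, by simpa using a.2⟩ : {l : List β // l ≠ []})) (h.of_enc' fun _ => rfl)))
      rintro ⟨_ | ⟨b, l⟩, hl⟩
      · exact absurd rfl hl
      · rfl
    refine (hh.comp h₁).of_enc fun a => ?_
    obtain ⟨a, ha⟩ := a
    have aux : ∀ l : List β, ∀ hl : l ≠ [],
        (l.casesOn (motive := fun _ => γ) (g a) (h a) : γ) = h a (l.head hl) l.tail := by
      rintro (_ | ⟨b, l⟩) hl
      · exact absurd rfl hl
      · rfl
    exact congrArg enc (aux _ _)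
  refine (cond' (g := fun a => (f a).casesOn (motive := fun _ => γ) (g a) (h a))
    (isEmpty.comp hf) (hg.comp (val _)) key).of_enc fun a => ?_
  cases f a <;> rfl

end PolyTime

/-! ### Folds, and the list and number functions derived from them -/

namespace PolyTime

open TreeProg

variable {α β γ δ σ : Type*} [TreeEncoding α] [TreeEncoding β] [TreeEncoding γ] [TreeEncoding δ]
  [TreeEncoding σ]

/-- The loop of a left fold: the main stack holds a list on top of a state and a parameter, and
`c` performs one step of the fold. -/
def foldLoop (c : TreeProg) : TreeProg :=
  .loop .main isTrue (.seq swap (.seq (.push .main true) (.seq c (.pop .main))))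

/-- The first symbol of the code of a list tells whether it is nonempty. In that case the swap and
the pushed `true` turn list and state into the code of `((x, a), b, l)`. The step `c` returns the
code of `(l, h a x b, a)`, and removing its leading `true` leaves the shorter list on top of the new
state. The bound `N` is required for every prefix since each intermediate state is swapped and
processed. -/
theorem runsIn_foldLoop {h : α → σ → β → σ} {c : TreeProg} {k : ℕ}
    (hc : ∀ (p : (σ × α) × β × List β) s,
      c.RunsIn (stack ((enc p).code ++ s)) ((treeSize p + 2) ^ k)
        (stack ((enc (p.2.2, h p.1.2 p.1.1 p.2.1, p.1.2)).code ++ s)))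
    (a : α) (s : List Bool) (N : ℕ) (l : List β) (x : σ)
    (hN : ∀ l₁ l₂, l = l₁ ++ l₂ → treeSize (l₁.foldl (h a) x) ≤ N) :
    (foldLoop c).RunsIn (stack ((enc l).code ++ ((enc (x, a)).code ++ s)))
      (l.length * (10 * treeSize l + 10 * (N + treeSize a + 1) + 9 +
        (N + treeSize a + treeSize l + 4) ^ k) + 1)
      (stack (false :: ((enc (l.foldl (h a) x, a)).code ++ s))) := by
  induction l generalizing x with
  | nil => exact (RunsIn.loop_false rfl).mono (by simp)
  | cons b l ih =>
    have ih' := ih (h a x b) fun l₁ l₂ hl => hN (b :: l₁) l₂ (by rw [hl]; rfl)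
    have hx : treeSize x ≤ N := hN [] _ rfl
    have h₁ := hc ((x, a), b, l) s
    have h₂ := RunsIn.loop_true (c := .seq swap (.seq (.push .main true) (.seq c (.pop .main))))
      (k := .main) (p := isTrue) rfl
      (.seq (runsIn_swap (enc (b :: l)) (enc (x, a)) s)
        (.seq (runsIn_push_main (x := true) ..) (.seq (t := stack (true ::
          ((enc l).code ++ ((enc (h a x b, a)).code ++ s))))
          (by simpa [enc, BinTree.code, stack] using h₁)
          (runsIn_pop_main ..)))) ih'
    refine RunsIn.mono h₂ ?_
    have e₁ : (enc (b :: l)).code.length = treeSize b + treeSize l + 1 := treeSize_cons b l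
    have e₂ : (enc (x, a)).code.length = treeSize x + treeSize a + 1 := treeSize_prod (x, a)
    rw [e₁, e₂]
    simp only [treeSize_cons, List.length_cons]
    have e₃ : (treeSize x + treeSize a + 1 + (treeSize b + treeSize l + 1) + 1 + 2) ^ k ≤
        (N + treeSize a + (treeSize b + treeSize l + 1) + 4) ^ k :=
      Nat.pow_le_pow_left (by omega) k
    have e₄ : (N + treeSize a + treeSize l + 4) ^ k ≤
        (N + treeSize a + (treeSize b + treeSize l + 1) + 4) ^ k :=
      Nat.pow_le_pow_left (by omega) k
    have e₅ : l.length * (10 * treeSize l + 10 * (N + treeSize a + 1) + 9 +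
        (N + treeSize a + treeSize l + 4) ^ k) ≤
        l.length * (10 * (treeSize b + treeSize l + 1) + 10 * (N + treeSize a + 1) + 9 +
        (N + treeSize a + (treeSize b + treeSize l + 1) + 4) ^ k) :=
      Nat.mul_le_mul_left _ (by omega)
    rw [add_mul]
    omega

/-- Left folds whose intermediate values are polynomially bounded. -/
theorem foldl {f : α → List β} {g : α → σ} {h : α → σ → β → σ} {q : α → ℕ} (hf : PolyTime f)
    (hg : PolyTime g) (hh : PolyTime fun p : α × σ × β => h p.1 p.2.1 p.2.2) (hq : PolyBounded q)
    (hb : ∀ a l₁ l₂, f a = l₁ ++ l₂ → treeSize (l₁.foldl (h a) (g a)) ≤ q a) :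
    PolyTime fun a => (f a).foldl (h a) (g a) := by
  have hinit : PolyTime fun a => (f a, g a, a) := hf.pair (hg.pair .id)
  have hstep : PolyTime fun p : (σ × α) × β × List β =>
      (p.2.2, h p.1.2 p.1.1 p.2.1, p.1.2) :=
    (snd.comp snd).pair ((hh.comp ((snd.comp fst).pair ((fst.comp fst).pair (fst.comp snd)))).pair
      (snd.comp fst))
  obtain ⟨-, c, t, ⟨k, hk⟩, hc⟩ := hstep
  obtain ⟨-, d, u, hu, hd⟩ := hinit
  have hlen : PolyBounded fun a => (f a).length := hf.bounded.of_le fun a => length_le_treeSize _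
  have hN := ((hq.add .size).add hf.bounded).add (.const 4)
  refine ⟨hq.of_le fun a => hb a (f a) [] (by simp), .seq d (.seq (.pop .main) (.seq (foldLoop c)
    (.seq (.pop .main) left))), _, hu.add ((PolyBounded.const 1).add
    (((hlen.mul (((((PolyBounded.const 10).mul hf.bounded).add ((PolyBounded.const 10).mul
      ((hq.add .size).add (.const 1)))).add (.const 9)).add (hN.pow k))).add (.const 1)).add
    ((PolyBounded.const 1).add (((PolyBounded.const 10).mul
      ((hq.add .size).add (.const 1))).add (.const 6))))), fun a s => ?_⟩
  have h₁ := runsIn_foldLoop (fun p s => (hc p s).mono (hk p)) a s (q a) (f a) (g a) (hb a)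
  have h₂ := runsIn_left (enc ((f a).foldl (h a) (g a))) (enc a) s
  have h₃ : ((enc ((f a).foldl (h a) (g a))).node (enc a)).code.length ≤
      q a + treeSize a + 1 := by
    have := treeSize_prod ((f a).foldl (h a) (g a), a)
    have := hb a (f a) [] (by simp)
    simp only [treeSize, enc, BinTree.code] at *
    omega
  refine .seq (hd a s) (.seq (t := stack ((enc (f a)).code ++ ((enc (g a, a)).code ++ s))) ?_
    (.seq h₁ (.seq (runsIn_pop_main ..) (h₂.mono (by gcongr)))))
  have := runsIn_pop_main [] ((enc (f a)).code ++ ((enc (g a, a)).code ++ s)) [] [] [] true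
  simpa [enc, BinTree.code, stack] using this

/-- Left folds whose steps increase the size by a polynomially bounded amount. -/
theorem foldl_of_step {f : α → List β} {g : α → σ} {h : α → σ → β → σ} {q : α → ℕ}
    (hf : PolyTime f) (hg : PolyTime g)
    (hh : PolyTime fun p : α × σ × β => h p.1 p.2.1 p.2.2) (hq : PolyBounded q)
    (hb : ∀ a x, ∀ b ∈ f a, treeSize (h a x b) ≤ treeSize x + q a) :
    PolyTime fun a => (f a).foldl (h a) (g a) := by
  refine foldl hf hg hh (hg.bounded.add ((hf.bounded.of_le fun a => length_le_treeSize _).mul hq))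
    fun a l₁ l₂ hl => ?_
  have key : ∀ l : List β, (∀ b ∈ l, b ∈ f a) → ∀ x, treeSize (l.foldl (h a) x) ≤
      treeSize x + l.length * q a := by
    intro l
    induction l with
    | nil => simp
    | cons b l ih =>
      intro hmem x
      have h₁ := ih (fun c hc => hmem c (List.mem_cons_of_mem b hc)) (h a x b)
      have h₂ := hb a x b (hmem b List.mem_cons_self)
      simp only [List.foldl_cons, List.length_cons, add_mul]
      omega
  refine (key l₁ (fun b hb => by simp [hl, hb]) (g a)).trans ?_
  gcongr
  simp [hl]

/-- Left folds whose states are bounded. -/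
theorem foldl_bool {f : α → List β} {g : α → Bool} {h : α → Bool → β → Bool}
    (hf : PolyTime f) (hg : PolyTime g)
    (hh : PolyTime fun p : α × Bool × β => h p.1 p.2.1 p.2.2) :
    PolyTime fun a => (f a).foldl (h a) (g a) :=
  foldl hf hg hh (.const 3) fun _ _ _ _ => treeSize_bool_le _

theorem and {f g : α → Bool} (hf : PolyTime f) (hg : PolyTime g) :
    PolyTime fun a => f a && g a :=
  (cond hf hg (.const false)).of_enc fun a => by cases f a <;> rfl

theorem or {f g : α → Bool} (hf : PolyTime f) (hg : PolyTime g) :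
    PolyTime fun a => f a || g a :=
  (cond hf (.const true) hg).of_enc fun a => by cases f a <;> rfl

theorem not {f : α → Bool} (hf : PolyTime f) : PolyTime fun a => !f a :=
  (cond hf (.const false) (.const true)).of_enc fun a => by cases f a <;> rfl

theorem any {f : α → List β} {p : α → β → Bool} (hf : PolyTime f)
    (hp : PolyTime fun q : α × β => p q.1 q.2) : PolyTime fun a => (f a).any (p a) := by
  refine (foldl_bool (h := fun a x b => x || p a b) hf (.const false)
    ((fst.comp snd).or (hp.comp (fst.pair (snd.comp snd))))).of_enc fun a => ?_
  congr 1
  have key : ∀ (l : List β) (x : Bool), l.foldl (fun x b => x || p a b) x = (x || l.any (p a)) := by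
    intro l
    induction l with
    | nil => simp
    | cons b l ih => intro x; simp [ih, Bool.or_assoc]
  rw [key, Bool.false_or]

theorem all {f : α → List β} {p : α → β → Bool} (hf : PolyTime f)
    (hp : PolyTime fun q : α × β => p q.1 q.2) : PolyTime fun a => (f a).all (p a) :=
  (any hf hp.not).not.of_enc fun a => by rw [List.all_eq_not_any_not]

theorem reverse {f : α → List β} (hf : PolyTime f) : PolyTime fun a => (f a).reverse := by
  refine (foldl_of_step (h := fun _ l b => b :: l) hf (.const [])
    ((snd.comp snd).cons (fst.comp snd)) (hf.bounded.add (.const 1)) fun a x b hb => ?_).of_enc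
    fun a => ?_
  · have := treeSize_le_of_mem hb
    simp; omega
  · simp

theorem append {f g : α → List β} (hf : PolyTime f) (hg : PolyTime g) :
    PolyTime fun a => f a ++ g a := by
  refine (foldl_of_step (h := fun _ l b => b :: l) hf.reverse hg
    ((snd.comp snd).cons (fst.comp snd)) (hf.bounded.add (.const 1)) fun a x b hb => ?_).of_enc
    fun a => ?_
  · have := treeSize_le_of_mem (List.mem_reverse.1 hb)
    simp; omega
  · simp

theorem flatMap {f : α → List β} {g : α → β → List γ} (hf : PolyTime f)
    (hg : PolyTime fun q : α × β => g q.1 q.2) : PolyTime fun a => (f a).flatMap (g a) := by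
  obtain ⟨k, hk⟩ := hg.bounded
  refine (foldl_of_step (h := fun a l b => l ++ g a b) hf (.const [])
    ((fst.comp snd).append (hg.comp (fst.pair (snd.comp snd))))
    (((PolyBounded.size.add hf.bounded).add (.const 3)).pow k) fun a x b hb => ?_).of_enc
    fun a => ?_
  · have h₁ := hk (a, b)
    have h₂ : (treeSize (a, b) + 2) ^ k ≤ (treeSize a + treeSize (f a) + 3) ^ k := by
      have := treeSize_le_of_mem hb
      rw [treeSize_prod]
      exact Nat.pow_le_pow_left (by simp; omega) k
    have h₃ := treeSize_append x (g a b)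
    dsimp only at h₁
    omega
  · congr 1
    have key : ∀ (l : List β) (x : List γ),
        l.foldl (fun l b => l ++ g a b) x = x ++ l.flatMap (g a) := by
      intro l
      induction l with
      | nil => simp
      | cons b l ih => intro x; simp [ih]
    rw [key, List.nil_append]

theorem map {f : α → List β} {g : α → β → γ} (hf : PolyTime f)
    (hg : PolyTime fun q : α × β => g q.1 q.2) : PolyTime fun a => (f a).map (g a) :=
  (flatMap (g := fun a b => [g a b]) hf (hg.cons (.const []))).of_enc fun a => by
    rw [List.map_eq_flatMap]

theorem filter {f : α → List β} {p : α → β → Bool} (hf : PolyTime f)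
    (hp : PolyTime fun q : α × β => p q.1 q.2) : PolyTime fun a => (f a).filter (p a) := by
  refine (flatMap (g := fun a b => bif p a b then [b] else []) hf
    (cond hp (snd.cons (.const [])) (.const []))).of_enc fun a => ?_
  congr 1
  induction f a with
  | nil => rfl
  | cons b l ih => cases h : p a b <;> simp [h, ih]

theorem tail {f : α → List β} (hf : PolyTime f) : PolyTime fun a => (f a).tail :=
  (list_casesOn (h := fun _ _ l => l) hf (.const []) (snd.comp snd)).of_enc fun a => by
    cases f a <;> rfl

theorem headD {f : α → List β} {g : α → β} (hf : PolyTime f) (hg : PolyTime g) :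
    PolyTime fun a => (f a).headD (g a) :=
  (list_casesOn (h := fun _ b _ => b) hf hg (fst.comp snd)).of_enc fun a => by
    cases f a <;> rfl

/-- Numbers are coded in unary, so arithmetic reduces to list operations: addition is concatenation,
truncated subtraction is `List.drop`. -/
theorem enc_nat (n : ℕ) : enc n = enc (List.replicate n ()) := by
  induction n with
  | zero => rfl
  | succ n ih => exact congrArg (BinTree.node .nil) ih

theorem replicate {f : α → ℕ} (hf : PolyTime f) : PolyTime fun a => List.replicate (f a) () :=
  hf.of_enc' fun _ => (enc_nat _).symm

theorem length {f : α → List β} (hf : PolyTime f) : PolyTime fun a => (f a).length :=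
  (map hf (.const ())).of_enc' fun a => by rw [enc_nat, List.map_const']

theorem succ {f : α → ℕ} (hf : PolyTime f) : PolyTime fun a => f a + 1 :=
  (cons (.const ()) hf.replicate).of_enc' fun a => by rw [enc_nat]; rfl

theorem add {f g : α → ℕ} (hf : PolyTime f) (hg : PolyTime g) : PolyTime fun a => f a + g a :=
  (hf.replicate.append hg.replicate).of_enc' fun a => by
    rw [enc_nat, List.replicate_add]

theorem drop {f : α → ℕ} {g : α → List β} (hf : PolyTime f) (hg : PolyTime g) :
    PolyTime fun a => (g a).drop (f a) := by
  refine (foldl_of_step (h := fun _ l _ => l.tail) hf.replicate hg (tail (fst.comp snd)) (.const 0)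
    fun a x b _ => ?_).of_enc fun a => ?_
  · cases x <;> simp; omega
  · congr 1
    have key : ∀ (n : ℕ) (l : List β),
        (List.replicate n ()).foldl (fun l _ => l.tail) l = l.drop n := by
      intro n
      induction n with
      | zero => simp
      | succ n ih => intro l; simp [List.replicate_succ, ih]
    exact (key _ _).symm

theorem getD {f : α → List β} {n : α → ℕ} {g : α → β} (hf : PolyTime f) (hn : PolyTime n)
    (hg : PolyTime g) : PolyTime fun a => (f a).getD (n a) (g a) :=
  (headD (drop hn hf) hg).of_enc fun a => by
    rw [List.getD_eq_getElem?_getD, List.headD_eq_head?_getD, List.head?_drop]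

theorem sub {f g : α → ℕ} (hf : PolyTime f) (hg : PolyTime g) : PolyTime fun a => f a - g a :=
  (drop hg hf.replicate).of_enc' fun a => by rw [enc_nat, List.drop_replicate]

theorem isZero {f : α → ℕ} (hf : PolyTime f) : PolyTime fun a => f a == 0 :=
  (isEmpty.comp hf.replicate).of_enc fun a => by cases f a <;> rfl

theorem beq {f g : α → ℕ} (hf : PolyTime f) (hg : PolyTime g) : PolyTime fun a => f a == g a :=
  ((hf.sub hg).isZero.and (hg.sub hf).isZero).of_enc fun a => by
    congr 1
    rw [Bool.eq_iff_iff]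
    simp only [beq_iff_eq, Bool.and_eq_true]
    omega

theorem treeSize_range_le {n m : ℕ} (h : n ≤ m) :
    treeSize (List.range n) ≤ m * (2 * m + 2) + 1 := by
  refine (treeSize_le_length_mul _ (2 * m + 1) fun k hk => ?_).trans ?_
  · rw [treeSize_nat]
    have := List.mem_range.1 hk
    omega
  · rw [List.length_range]
    gcongr

theorem range {f : α → ℕ} (hf : PolyTime f) : PolyTime fun a => List.range (f a) := by
  have key : ∀ n, (List.replicate n ()).foldl (fun l _ => 0 :: l.map (· + 1)) [] =
      List.range n := by
    intro n
    induction n with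
    | zero => rfl
    | succ n ih =>
      rw [List.replicate_succ', List.foldl_append, ih, List.range_succ_eq_map]
      rfl
  -- Every intermediate state is the range of a smaller number, so its size is at most quadratic,
  -- although a single step enlarges all entries of the list.
  refine (foldl (h := fun _ l _ => 0 :: l.map (· + 1)) hf.replicate (.const [])
    (cons (.const 0) (map (g := fun _ k => k + 1) (fst.comp snd) snd.succ))
    (((hf.bounded).mul (((PolyBounded.const 2).mul hf.bounded).add (.const 2))).add (.const 1))
    fun a l₁ l₂ hl => ?_).of_enc fun a => by rw [key]
  have h₁ : l₁ = List.replicate l₁.length () :=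
    List.eq_replicate_iff.2 ⟨rfl, fun _ _ => rfl⟩
  have h₂ : l₁.length ≤ f a := by
    have := congrArg List.length hl
    simp at this; omega
  rw [h₁, key]
  exact treeSize_range_le (h₂.trans (by rw [treeSize_nat]; omega))

theorem listBeq {f g : α → List ℕ} (hf : PolyTime f) (hg : PolyTime g) :
    PolyTime fun a => f a == g a := by
  have h₁ : PolyTime fun q : α × ℕ => (f q.1).getD q.2 0 == (g q.1).getD q.2 0 :=
    ((hf.comp fst).getD snd (.const 0)).beq ((hg.comp fst).getD snd (.const 0))
  refine ((hf.length.beq hg.length).and (all (p := fun a i => (f a).getD i 0 == (g a).getD i 0)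
    hf.length.range h₁)).of_enc fun a => ?_
  congr 1
  rw [Bool.eq_iff_iff]
  simp only [beq_iff_eq, Bool.and_eq_true, List.all_eq_true, List.mem_range]
  constructor
  · intro h; simp [h]
  · rintro ⟨h₁, h₂⟩
    refine List.ext_getElem h₁ fun i hi hi' => ?_
    simpa [hi, hi'] using h₂ i hi

end PolyTime

/-! ### Input words as trees, and the passage to Turing machines -/

open Computability (Γ')

/-- The code of a symbol is that of the pair of its `isBit` and `symbolValue`, which makes both
computable at no cost. Brackets and blank need not be told apart, since parsing ignores them. -/
instance : TreeEncoding Γ' where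
  enc
    | .bit b => enc (true, b)
    | .comma => enc (false, true)
    | _ => enc (false, false)

namespace TreeProg

/-- Push a list on the first auxiliary stack, the first element first. -/
def pushFst : List Bool → TreeProg
  | [] => .skip
  | x :: l => .seq (.push .fst x) (pushFst l)

theorem runsIn_pushFst (l : List Bool) (i : List Γ') (s a b c : List Bool) :
    RunsIn (pushFst l) (mem i s a b c) (l.length + 1) (mem i s (l.reverse ++ a) b c) := by
  induction l generalizing a with
  | nil => exact .skip
  | cons x l ih =>
    rw [List.reverse_cons, List.append_assoc]
    exact (RunsIn.seq (runsIn_push_fst ..) (ih _)).mono (by simp; omega)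

/-- Translate a symbol on top of the input stack. -/
def readSymbol : TreeProg :=
  .ite .inp (· == some (.bit true)) (pushFst (true :: (enc (Γ'.bit true)).code)) <|
  .ite .inp (· == some (.bit false)) (pushFst (true :: (enc (Γ'.bit false)).code)) <|
  .ite .inp (· == some .comma) (pushFst (true :: (enc Γ'.comma).code))
    (pushFst (true :: (enc Γ'.blank).code))

theorem runsIn_readSymbol (x : Γ') (i : List Γ') (s a b c : List Bool) :
    RunsIn readSymbol (mem (x :: i) s a b c) 12
      (mem (x :: i) s ((true :: (enc x).code).reverse ++ a) b c) := by
  cases x with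
  | bit v =>
    cases v
    · exact (RunsIn.ite_false rfl (.ite_true rfl (runsIn_pushFst ..))).mono (by decide)
    · exact (RunsIn.ite_true rfl (runsIn_pushFst ..)).mono (by decide)
  | comma =>
    exact (RunsIn.ite_false rfl (.ite_false rfl (.ite_true rfl (runsIn_pushFst ..)))).mono
      (by decide)
  | blank | bra | ket =>
    exact (RunsIn.ite_false rfl (.ite_false rfl (.ite_false rfl (runsIn_pushFst ..)))).mono
      (by decide)

/-- Replace the word on the input stack by its code on the main stack. -/
def readInput : TreeProg :=
  .seq (.loop .inp Option.isSome (.seq readSymbol (.pop .inp))) (.seq (.push .fst false) ofFst)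

theorem runsIn_readInput_loop (w : List Γ') (a : List Bool) :
    RunsIn (.loop .inp Option.isSome (.seq readSymbol (.pop .inp))) (mem w [] a [] [])
      (14 * w.length + 1)
      (mem [] [] ((w.flatMap fun x => true :: (enc x).code).reverse ++ a) [] []) := by
  induction w generalizing a with
  | nil => exact (RunsIn.loop_false rfl).mono (by simp)
  | cons x w ih =>
    have := RunsIn.loop_true rfl (.seq (runsIn_readSymbol x w [] a [] []) (runsIn_pop_inp ..))
      (ih _)
    rw [List.flatMap_cons, List.reverse_append, List.append_assoc]
    exact this.mono (by simp; omega)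

theorem code_enc_word (w : List Γ') :
    (enc w).code = (w.flatMap fun x => true :: (enc x).code) ++ [false] := by
  induction w with
  | nil => rfl
  | cons x w ih =>
    rw [List.flatMap_cons, List.append_assoc, ← ih]; rfl

theorem treeSize_word_le (w : List Γ') : treeSize w ≤ 8 * w.length + 1 := by
  refine (treeSize_le_length_mul w 7 fun x _ => ?_).trans (by omega)
  rcases x with _ | ⟨_ | _⟩ | _ | _ | _ <;> decide

theorem runsIn_readInput (w : List Γ') :
    RunsIn readInput (mem w [] [] [] []) (46 * w.length + 7) (stack (enc w).code) := by
  have := RunsIn.seq (runsIn_readInput_loop w []) (.seq (runsIn_push_fst (x := false) ..)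
    (runsIn_ofFst ..))
  have hw := treeSize_word_le w
  rw [treeSize, code_enc_word] at hw
  rw [code_enc_word]
  simp only [List.append_nil, List.reverse_cons, List.reverse_reverse] at this
  refine this.mono ?_
  simp only [List.length_append, List.length_cons, List.length_reverse, List.length_nil] at hw ⊢
  omega

/-- Replace the code of a Boolean by the Boolean. -/
def writeOutput : TreeProg :=
  .ite .main isTrue (.seq drop (.push .main true)) .skip

theorem runsIn_writeOutput (v : Bool) :
    RunsIn writeOutput (stack (enc v).code) 22 (stack [v]) := by
  cases v
  · exact (RunsIn.ite_false rfl .skip).mono (by decide)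
  · exact (RunsIn.ite_true rfl (.seq (runsIn_drop (enc true) [] [] []) (runsIn_push_main ..))).mono
      (by decide)

end TreeProg

open TreeProg in
/-- A Boolean function that is computed in polynomial time by a program on binary trees is computed
in polynomial time by a Turing machine. -/
theorem PolyTime.tm2ComputableInPolyTime {α : Type} [TreeEncoding α] {w : α → List Γ'}
    (hw : ∀ a, enc a = enc (w a)) {f : α → Bool} (hf : PolyTime f) :
    Nonempty (TM2ComputableInPolyTime w Computability.encodeBool f) := by
  obtain ⟨-, c, t, ⟨k, hk⟩, hc⟩ := hf
  have key (a : α) : RunsIn (.seq readInput (.seq c writeOutput)) (mem (w a) [] [] [] [])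
      (46 * (w a).length + 7 + ((8 * (w a).length + 3) ^ k + 22)) (stack [f a]) := by
    refine .seq (runsIn_readInput (w a)) (.seq ?_ (runsIn_writeOutput (f a)))
    have := (hc a []).mono (hk a)
    rw [List.append_nil, List.append_nil, hw] at this
    refine this.mono (Nat.pow_le_pow_left ?_ k)
    have := treeSize_word_le (w a)
    rw [treeSize] at *
    rw [hw]
    omega
  choose n hn hr using key
  refine ⟨
    { tm := (StackProg.seq readInput (.seq c writeOutput)).toFinTM2 .inp .main
      inputAlphabet := Equiv.refl _
      outputAlphabet := Equiv.refl _
      -- A symbol contributes at most 8 to the code of the word: 7 for its own code and 1 for the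
      -- list node. So the argument of `c` has size at most `8 * X + 1`. The 8 is the 7 from
      -- `runsIn_readInput` plus the halting step.
      time := 46 * Polynomial.X + 8 + ((8 * Polynomial.X + 3) ^ k + 22)
      outputsFun := fun a => ⟨⟨n a + 1, ?_⟩, ?_⟩ }⟩
  · have h := (hr a).toFinTM2 (k₀ := .inp) (k₁ := .main)
    refine Eq.trans (congrArg _ ?_) (h.trans ?_)
    · refine congrArg some (congrArg (TM2.Cfg.mk _ _) ?_)
      funext k
      cases k
      · exact List.map_id _
      all_goals rfl
    · refine congrArg some (congrArg (TM2.Cfg.mk _ _) ?_)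
      funext k
      cases k <;> rfl
  · have := hn a
    simp only [Polynomial.eval_add, Polynomial.eval_mul, Polynomial.eval_pow, Polynomial.eval_X,
      Polynomial.eval_ofNat]
    omega

/-! ### Recovering an instance from its input word -/

namespace ARHInstance

instance : TreeEncoding ARHInstance := ⟨fun I => enc I.encode⟩

/-- Is the symbol a bit? -/
def isBit : Γ' → Bool
  | .bit _ => true
  | _ => false

/-- The value of a bit; among the other symbols, only the comma has the value `true`. -/
def symbolValue : Γ' → Bool
  | .bit b => b
  | .comma => true
  | _ => false

/-- Process a symbol in front of a list of rows: a comma starts a new row, and a bit is put in front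
of the first row. -/
def consSymbol (x : Γ') (l : List (List Bool)) : List (List Bool) :=
  bif isBit x then l.casesOn (motive := fun _ => List (List Bool)) []
    fun r l => (symbolValue x :: r) :: l
  else bif symbolValue x then [] :: l else l

/-- The comma-separated rows of bits in a word. -/
def parseRows (w : List Γ') : List (List Bool) := w.foldr consSymbol []

theorem foldr_consSymbol_bits (s : List Bool) (r : List Bool) (l : List (List Bool)) :
    (s.map Γ'.bit).foldr consSymbol (r :: l) = (s ++ r) :: l := by
  induction s with
  | nil => rfl
  | cons b s ih => simp [ih, consSymbol, isBit, symbolValue]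

/-- Rows are closed by commas, so the right-to-left scan first meets the comma, which opens an empty
row, and then fills that row from its back. -/
theorem foldr_consSymbol_row {n : ℕ} (s : Fin n → Bool) (l : List (List Bool)) :
    (encodeRow s).foldr consSymbol l = List.ofFn s :: l := by
  have : (List.ofFn fun k => Γ'.bit (s k)) = (List.ofFn s).map Γ'.bit := by
    rw [List.map_ofFn]; rfl
  rw [encodeRow, this, List.foldr_append]
  exact (foldr_consSymbol_bits _ [] l).trans (by rw [List.append_nil])

theorem foldr_consSymbol_unary (n : ℕ) (l : List (List Bool)) :
    (encodeUnary n).foldr consSymbol l = List.replicate n true :: l := by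
  have : List.replicate n (Γ'.bit true) = (List.replicate n true).map Γ'.bit := by simp
  rw [encodeUnary, this, List.foldr_append]
  exact (foldr_consSymbol_bits _ [] l).trans (by rw [List.append_nil])

theorem foldr_consSymbol_flatten {r : ℕ} (w : Fin r → List Γ') (s : Fin r → List (List Bool))
    (h : ∀ i l, (w i).foldr consSymbol l = s i ++ l) (l : List (List Bool)) :
    (List.ofFn w).flatten.foldr consSymbol l = (List.ofFn s).flatten ++ l := by
  induction r with
  | zero => simp
  | succ r ih =>
    rw [List.ofFn_succ, List.ofFn_succ, List.flatten_cons, List.flatten_cons, List.foldr_append,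
      ih _ _ (fun i => h i.succ), h, List.append_assoc]

theorem flatten_ofFn_singleton {α : Type*} {r : ℕ} (f : Fin r → α) :
    (List.ofFn fun i => [f i]).flatten = List.ofFn f := by
  induction r with
  | zero => simp
  | succ r ih => simp [List.ofFn_succ, ih]

variable (I : ARHInstance)

/-- The rows of bits in the input word of an instance. -/
def rows : List (List Bool) := parseRows I.encode

theorem rows_eq : I.rows = List.replicate I.numVertices true :: List.replicate I.numRefugees true ::
    ((List.ofFn fun u : I.Vertex => List.ofFn fun v : I.Vertex => decide (I.topology.Adj u v)) ++
    (List.ofFn fun i : I.Inhabitant =>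
      [List.ofFn fun v : I.Vertex => decide (I.assignment i = v),
        List.ofFn fun k : I.Vertex => decide ((k : ℕ) ∈ I.approval i)]).flatten) := by
  have hbra : ∀ l, consSymbol .bra l = l := fun _ => rfl
  have hket : ∀ l, consSymbol .ket l = l := fun _ => rfl
  simp only [rows, parseRows, encode, List.foldr_append, List.foldr_cons, List.foldr_nil, hbra, hket]
  rw [foldr_consSymbol_unary, foldr_consSymbol_unary,
    foldr_consSymbol_flatten _
      (fun u : I.Vertex => [List.ofFn fun v : I.Vertex => decide (I.topology.Adj u v)]),
    foldr_consSymbol_flatten _ (fun i : I.Inhabitant =>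
      [List.ofFn fun v : I.Vertex => decide (I.assignment i = v),
        List.ofFn fun k : I.Vertex => decide ((k : ℕ) ∈ I.approval i)])]
  · rw [List.append_nil]
    rw [flatten_ofFn_singleton]
  · intro i l
    rw [List.foldr_append, foldr_consSymbol_row, foldr_consSymbol_row]
    rfl
  · intro u l
    rw [foldr_consSymbol_row]
    rfl

theorem getD_flatten_pairs {α : Type*} {r : ℕ} (f g : Fin r → α) (d : α) (k : ℕ) :
    (List.ofFn fun i => [f i, g i]).flatten.getD (2 * k) d = (if h : k < r then f ⟨k, h⟩ else d) ∧
    (List.ofFn fun i => [f i, g i]).flatten.getD (2 * k + 1) d =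
      (if h : k < r then g ⟨k, h⟩ else d) := by
  induction r generalizing k with
  | zero => simp
  | succ r ih =>
    cases k with
    | zero => simp [List.ofFn_succ]
    | succ k =>
      have := ih (fun i => f i.succ) (fun i => g i.succ) k
      simp only [List.getD_eq_getElem?_getD] at this
      simpa [List.ofFn_succ, mul_add, add_right_comm _ 2 1] using this

theorem getD_ofFn {α : Type*} {r : ℕ} (f : Fin r → α) (d : α) (k : ℕ) :
    (List.ofFn f).getD k d = if h : k < r then f ⟨k, h⟩ else d := by
  rw [List.getD_eq_getElem?_getD, List.getElem?_ofFn]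
  split <;> simp_all

/-- Are the vertices with two given labels adjacent? -/
def adj (u v : ℕ) : Bool :=
  if h : u < I.numVertices ∧ v < I.numVertices then
    decide (I.topology.Adj ⟨u, h.1⟩ ⟨v, h.2⟩) else false

/-- Is the vertex with a given label occupied by an inhabitant? -/
def occ (v : ℕ) : Bool := decide (∃ i, (I.assignment i : ℕ) = v)

/-- Does the inhabitant of the vertex with a given label, if there is one, approve a given number
of refugees? -/
def ok (u c : ℕ) : Bool := decide (∀ i, (I.assignment i : ℕ) = u → c ∈ I.approval i)

theorem length_rows_zero : (I.rows.getD 0 []).length = I.numVertices := by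
  simp [rows_eq]

theorem length_rows_one : (I.rows.getD 1 []).length = I.numRefugees := by
  simp [rows_eq]

theorem adj_eq (u v : ℕ) :
    (bif (u + 1 - I.numVertices == 0) && (v + 1 - I.numVertices == 0) then
      (I.rows.getD (u + 2) []).getD v false else false) = I.adj u v := by
  unfold adj
  split
  case isTrue h =>
    -- Vanishing of this truncated difference means `u < n`. Without this test, a large `u` would
    -- address a row belonging to an inhabitant.
    have h₁ : u + 1 - I.numVertices = 0 := by omega
    have h₂ : v + 1 - I.numVertices = 0 := by omega
    have h₃ : I.rows.getD (u + 2) [] =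
        List.ofFn fun v : I.Vertex => decide (I.topology.Adj ⟨u, h.1⟩ v) := by
      simp [rows_eq, List.getElem?_append, h.1]
    rw [h₃, h₁, h₂, getD_ofFn, dif_pos h.2]
    rfl
  case isFalse h =>
    have : ¬ (u + 1 - I.numVertices = 0 ∧ v + 1 - I.numVertices = 0) := by omega
    have h₁ : ((u + 1 - I.numVertices == 0) && (v + 1 - I.numVertices == 0)) = false := by
      rw [Bool.eq_false_iff]; simpa using this
    rw [h₁]; rfl

theorem rows_inhabitant (k : ℕ) :
    I.rows.getD (I.numVertices + 2 + 2 * k) [] = (if h : k < I.numInhabitants then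
      List.ofFn fun v : I.Vertex => decide (I.assignment ⟨k, h⟩ = v) else []) ∧
    I.rows.getD (I.numVertices + 2 + (2 * k + 1)) [] = (if h : k < I.numInhabitants then
      List.ofFn fun c : I.Vertex => decide ((c : ℕ) ∈ I.approval ⟨k, h⟩) else []) := by
  have key (m : ℕ) : I.rows.getD (I.numVertices + 2 + m) [] = (List.ofFn fun i : I.Inhabitant =>
      [List.ofFn fun v : I.Vertex => decide (I.assignment i = v),
        List.ofFn fun k : I.Vertex => decide ((k : ℕ) ∈ I.approval i)]).flatten.getD m [] := by
    rw [rows_eq, show I.numVertices + 2 + m = (I.numVertices + m) + 1 + 1 by ring]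
    simp only [List.getD_cons_succ]
    rw [List.getD_append_right _ _ _ _ (by simp)]
    simp
  rw [key, key]
  exact getD_flatten_pairs _ _ _ _

theorem numInhabitants_le : I.numInhabitants ≤ I.numVertices := by
  have := I.agents_le; omega

/-- The input word does not list the number of inhabitants, so `k` runs up to the number of
vertices. The rows beyond the last inhabitant are empty by default and contribute `false`. -/
theorem occ_eq (v : ℕ) : ((List.range I.numVertices).any fun k =>
    (I.rows.getD (I.numVertices + 2 + 2 * k) []).getD v false) = I.occ v := by
  rw [Bool.eq_iff_iff]
  simp only [List.any_eq_true, List.mem_range, occ, decide_eq_true_eq]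
  constructor
  · rintro ⟨k, hk, h⟩
    rw [(I.rows_inhabitant k).1] at h
    split at h
    case isTrue h' =>
      rw [getD_ofFn] at h
      split at h
      case isTrue hv => exact ⟨⟨k, h'⟩, by simpa [Fin.ext_iff] using h⟩
      case isFalse => simp at h
    case isFalse => simp at h
  · rintro ⟨i, rfl⟩
    refine ⟨i, i.2.trans_le I.numInhabitants_le, ?_⟩
    rw [(I.rows_inhabitant i).1, dif_pos i.2, getD_ofFn, dif_pos (I.assignment i).2]
    simp

theorem lt_of_mem_approval {i : I.Inhabitant} {c : ℕ} (h : c ∈ I.approval i) :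
    c < I.numVertices := by
  have h₁ := Finset.mem_range.1 (I.approval_subset i h)
  have h₂ := I.topology.degree_lt_card_verts (I.assignment i)
  rw [Fintype.card_fin] at h₂
  omega

/-- The default `false` beyond the end of an approval vector is the right value because approved
numbers are smaller than the number of vertices. Missing inhabitants fail the premise and impose no
condition. -/
theorem ok_eq (u c : ℕ) : ((List.range I.numVertices).all fun k =>
    !((I.rows.getD (I.numVertices + 2 + 2 * k) []).getD u false) ||
      (I.rows.getD (I.numVertices + 2 + (2 * k + 1)) []).getD c false) = I.ok u c := by
  rw [Bool.eq_iff_iff]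
  simp only [List.all_eq_true, List.mem_range, ok, decide_eq_true_eq, Bool.or_eq_true,
    Bool.not_eq_true']
  constructor
  · rintro h i rfl
    have := h i (i.2.trans_le I.numInhabitants_le)
    rw [(I.rows_inhabitant i).1, (I.rows_inhabitant i).2, dif_pos i.2, dif_pos i.2, getD_ofFn,
      getD_ofFn, dif_pos (I.assignment i).2] at this
    split at this <;> simp_all
  · intro h k hk
    rw [(I.rows_inhabitant k).1, (I.rows_inhabitant k).2]
    split
    case isTrue h' =>
      rw [getD_ofFn, getD_ofFn, or_iff_not_imp_left]
      intro hu
      split at hu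
      case isTrue hu' =>
        have := h ⟨k, h'⟩ (by simpa [Fin.ext_iff] using hu)
        rw [dif_pos (I.lt_of_mem_approval this)]
        simpa using this
      case isFalse => simp at hu
    case isFalse => simp

end ARHInstance

namespace PolyTime

open ARHInstance

variable {α : Type*} [TreeEncoding α]

theorem isBit_symbolValue : PolyTime fun x : Γ' => (isBit x, symbolValue x) :=
  of_enc_eq fun x => by cases x <;> rfl

theorem isBit {f : α → Γ'} (hf : PolyTime f) : PolyTime fun a => isBit (f a) :=
  (fst.comp isBit_symbolValue).comp hf

theorem symbolValue {f : α → Γ'} (hf : PolyTime f) : PolyTime fun a => symbolValue (f a) :=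
  (snd.comp isBit_symbolValue).comp hf

theorem treeSize_consSymbol_le (x : Γ') (l : List (List Bool)) :
    treeSize (consSymbol x l) ≤ treeSize l + 4 := by
  unfold consSymbol
  cases ARHInstance.isBit x
  · cases ARHInstance.symbolValue x <;> simp; omega
  · have := treeSize_bool_le (ARHInstance.symbolValue x)
    cases l <;> simp; omega

theorem parseRows : PolyTime parseRows := by
  refine (foldl_of_step (f := fun w : List Γ' => w.reverse) (h := fun _ l x => consSymbol x l)
    (reverse .id) (.const []) ?_ (.const 4) fun _ l x _ => treeSize_consSymbol_le x l).of_enc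
    fun w => ?_
  · have hx : PolyTime fun p : List Γ' × List (List Bool) × Γ' => p.2.2 := snd.comp snd
    have hl : PolyTime fun p : List Γ' × List (List Bool) × Γ' => p.2.1 := fst.comp snd
    exact cond hx.isBit (list_casesOn (h := fun p r l => (ARHInstance.symbolValue p.2.2 :: r) :: l)
      hl (.const []) (((hx.symbolValue.comp fst).cons (fst.comp snd)).cons (snd.comp snd)))
      (cond hx.symbolValue ((PolyTime.const []).cons hl) hl)
  · rw [List.foldl_reverse]; rfl

theorem rows : PolyTime ARHInstance.rows :=
  (parseRows.comp (f := fun I : ARHInstance => I.encode) (of_enc_eq fun _ => rfl))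

variable {I : α → ARHInstance} {u v : α → ℕ}

theorem numVertices (hI : PolyTime I) : PolyTime fun a => (I a).numVertices :=
  (length (getD (rows.comp hI) (.const 0) (.const []))).of_enc fun a => by rw [length_rows_zero]

theorem numRefugees (hI : PolyTime I) : PolyTime fun a => (I a).numRefugees :=
  (length (getD (rows.comp hI) (.const 1) (.const []))).of_enc fun a => by rw [length_rows_one]

theorem adj (hI : PolyTime I) (hu : PolyTime u) (hv : PolyTime v) :
    PolyTime fun a => (I a).adj (u a) (v a) :=
  (cond ((hu.succ.sub hI.numVertices).isZero.and (hv.succ.sub hI.numVertices).isZero)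
    (((rows.comp hI).getD hu.succ.succ (.const [])).getD hv (.const false)) (.const false)).of_enc
    fun a => by rw [← adj_eq]

theorem occ (hI : PolyTime I) (hv : PolyTime v) : PolyTime fun a => (I a).occ (v a) := by
  refine (any (p := fun a k =>
      ((I a).rows.getD ((I a).numVertices + 2 + (k + k)) []).getD (v a) false)
    hI.numVertices.range (((rows.comp (hI.comp fst)).getD
      ((hI.comp fst).numVertices.succ.succ.add (snd.add snd)) (.const [])).getD (hv.comp fst)
      (.const false))).of_enc fun a => ?_
  simp only [← occ_eq, two_mul]

theorem ok (hI : PolyTime I) (hu : PolyTime u) (hv : PolyTime v) :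
    PolyTime fun a => (I a).ok (u a) (v a) := by
  have hr := rows.comp (hI.comp (fst (β := ℕ)))
  have hn := (hI.comp (fst (β := ℕ))).numVertices.succ.succ
  refine (all (p := fun a k =>
      !(((I a).rows.getD ((I a).numVertices + 2 + (k + k)) []).getD (u a) false) ||
      ((I a).rows.getD ((I a).numVertices + 2 + (k + k + 1)) []).getD (v a) false)
    hI.numVertices.range
    (((hr.getD (hn.add (snd.add snd)) (.const [])).getD (hu.comp fst) (.const false)).not.or
      ((hr.getD (hn.add (snd.add snd).succ) (.const [])).getD (hv.comp fst)
        (.const false)))).of_enc fun a => ?_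
  simp only [← ok_eq, two_mul]

end PolyTime

/-! ### The dynamic program -/

namespace ARHInstance

variable (I : ARHInstance)

/-- The labels of the vertices. -/
abbrev labels : List ℕ := List.range I.numVertices

/-- Are all neighbours of the vertex `u` in the list `P`? -/
def done (P : List ℕ) (u : ℕ) : Bool :=
  I.labels.all fun w => !I.adj u w || P.any (· == w)

/-- Are some but not all neighbours of the vertex `u` in the list `P`? -/
def pending (P : List ℕ) (u : ℕ) : Bool :=
  !I.done P u && I.labels.any fun w => I.adj u w && P.any (· == w)

/-- The vertices outside the list `P`. -/
def rest (P : List ℕ) : List ℕ := I.labels.filter fun v => !P.any (· == v)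

/-- The vertices outside the list `P` that are adjacent to pending vertices. -/
def preferred (P : List ℕ) : List ℕ :=
  (I.rest P).filter fun v => I.labels.any fun u => I.pending P u && I.adj u v

/-- The vertex to be processed after the vertices in the list `P`. -/
def choose (P : List ℕ) : ℕ := (I.preferred P ++ I.rest P).headD 0

/-- The numbers of refugees next to every vertex, when the vertex `v` is processed, and receives a
refugee or not. -/
def place (v : ℕ) (y : List ℕ) (b : Bool) : List ℕ :=
  I.labels.map fun u => bif b && I.adj u v then y.getD u 0 + 1 else y.getD u 0

/-- Do all inhabitants next to `v`, all of whose neighbours have been processed, approve the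
number of refugees? -/
def approved (P : List ℕ) (v : ℕ) (y : List ℕ) : Bool :=
  I.labels.all fun u => !(I.adj u v && I.done P u) || I.ok u (y.getD u 0)

/-- Forget the number of refugees next to vertices all of whose neighbours have been processed. -/
def forget (P : List ℕ) (y : List ℕ) : List ℕ :=
  I.labels.map fun u => bif I.done P u then 0 else y.getD u 0

/-- The extension of a partial solution by a decision about the vertex `v`. -/
def extendBy (P : List ℕ) (v : ℕ) (p : List ℕ × ℕ) (b : Bool) : List (List ℕ × ℕ) :=
  bif I.approved (v :: P) v (I.place v p.1 b) then
    [(I.forget (v :: P) (I.place v p.1 b), bif b then p.2 + 1 else p.2)] else []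

/-- The extensions of a partial solution by the vertex `v`. -/
def extend (P : List ℕ) (v : ℕ) (p : List ℕ × ℕ) : List (List ℕ × ℕ) :=
  I.extendBy P v p false ++ bif I.occ v then [] else I.extendBy P v p true

/-- Insert a pair into a list of pairs, unless it is there already. -/
def insertPair (l : List (List ℕ × ℕ)) (p : List ℕ × ℕ) : List (List ℕ × ℕ) :=
  bif l.any fun q => q.1 == p.1 && q.2 == p.2 then l else p :: l

/-- The state of the algorithm: the processed vertices, and for every partial solution the numbers
of refugees next to every vertex and the total number of refugees. -/
abbrev State : Type := List ℕ × List (List ℕ × ℕ)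

/-- Process one vertex. -/
def next (s : State) : State :=
  (I.choose s.1 :: s.1, (s.2.flatMap (I.extend s.1 (I.choose s.1))).foldl insertPair [])

/-- The initial state. -/
def start : State :=
  ([], bif I.labels.all fun u => !I.done [] u || I.ok u 0 then [(I.labels.map fun _ => 0, 0)]
    else [])

/-- The state after `k` vertices have been processed. -/
def run (k : ℕ) : State := (List.range k).foldl (fun s _ => I.next s) I.start

/-- The answer of the algorithm. -/
def answer : Bool := (I.run I.numVertices).2.any fun p => p.2 == I.numRefugees

/-! ### Correctness of the dynamic program on all graphs -/

section correctness

/-- The number of neighbours of `u` in `X`. -/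
def count (X : Finset ℕ) (u : ℕ) : ℕ := (X.filter fun v => I.adj u v = true).card

theorem any_beq (P : List ℕ) (w : ℕ) : P.any (· == w) = true ↔ w ∈ P := by
  simp [List.any_eq_true]

theorem any_beq_eq_false (P : List ℕ) (w : ℕ) : P.any (· == w) = false ↔ w ∉ P := by
  rw [← any_beq, Bool.not_eq_true]

theorem done_iff {P : List ℕ} {u : ℕ} :
    I.done P u = true ↔ ∀ w < I.numVertices, I.adj u w = true → w ∈ P := by
  simp only [done, List.all_eq_true, List.mem_range, Bool.or_eq_true, any_beq,
    Bool.not_eq_true', ← Bool.not_eq_true, ← imp_iff_not_or]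

theorem pending_iff {P : List ℕ} {u : ℕ} :
    I.pending P u = true ↔ I.done P u = false ∧ ∃ w < I.numVertices, I.adj u w = true ∧ w ∈ P := by
  simp only [pending, Bool.and_eq_true, List.any_eq_true, List.mem_range, Bool.not_eq_true',
    beq_iff_eq, exists_eq_right]

theorem mem_rest {P : List ℕ} {v : ℕ} : v ∈ I.rest P ↔ v < I.numVertices ∧ v ∉ P := by
  simp only [rest, List.mem_filter, List.mem_range, Bool.not_eq_true', any_beq_eq_false]

theorem mem_preferred {P : List ℕ} {v : ℕ} : v ∈ I.preferred P ↔
    v ∈ I.rest P ∧ ∃ u < I.numVertices, I.pending P u = true ∧ I.adj u v = true := by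
  simp only [preferred, List.mem_filter, List.any_eq_true, List.mem_range, Bool.and_eq_true]

theorem choose_mem_preferred {P : List ℕ} (h : I.preferred P ≠ []) :
    I.choose P ∈ I.preferred P := by
  unfold choose
  cases hp : I.preferred P with
  | nil => exact absurd hp h
  | cons v l => simp

theorem choose_mem_rest {P : List ℕ} (h : I.rest P ≠ []) : I.choose P ∈ I.rest P := by
  by_cases hp : I.preferred P = []
  · unfold choose
    rw [hp]
    cases hr : I.rest P with
    | nil => exact absurd hr h
    | cons v l => simp
  · exact (I.mem_preferred.1 (I.choose_mem_preferred hp)).1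

theorem rest_ne_nil {P : List ℕ} (h : P.length < I.numVertices) : I.rest P ≠ [] := by
  intro hr
  have : Finset.range I.numVertices ⊆ P.toFinset := by
    intro v hv
    by_contra hP
    have : v ∈ I.rest P := I.mem_rest.2 ⟨Finset.mem_range.1 hv, by simpa using hP⟩
    rw [hr] at this
    simp at this
  have := (Finset.card_le_card this).trans P.toFinset_card_le
  rw [Finset.card_range] at this
  omega

theorem adj_comm (u v : ℕ) : I.adj u v = I.adj v u := by
  unfold adj
  by_cases h : u < I.numVertices ∧ v < I.numVertices
  · rw [dif_pos h, dif_pos h.symm, decide_eq_decide, SimpleGraph.adj_comm]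
  · rw [dif_neg h, dif_neg fun h' => h h'.symm]

theorem lt_of_adj {u v : ℕ} (h : I.adj u v = true) : u < I.numVertices ∧ v < I.numVertices := by
  unfold adj at h
  split at h
  · assumption
  · simp at h

/-- The row of a partial solution with refugees on `X`, when the vertices in `P` have been
processed. -/
def summary (P : List ℕ) (X : Finset ℕ) : List ℕ × ℕ :=
  (I.labels.map fun u => bif I.done P u then 0 else I.count X u, X.card)

/-- A set of vertices for refugees is a partial solution, when the vertices in `P` have been
processed. -/
def IsPartial (P : List ℕ) (X : Finset ℕ) : Prop :=
  (∀ v ∈ X, v ∈ P ∧ I.occ v = false) ∧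
    ∀ u < I.numVertices, I.done P u = true → I.ok u (I.count X u) = true

theorem getD_map_range (f : ℕ → ℕ) {n u : ℕ} (hu : u < n) :
    ((List.range n).map f).getD u 0 = f u := by
  simp [hu]

theorem count_insert {X : Finset ℕ} {v u : ℕ} (hv : v ∉ X) :
    I.count (insert v X) u = bif I.adj u v then I.count X u + 1 else I.count X u := by
  unfold count
  rw [Finset.filter_insert]
  cases h : I.adj u v
  · simp
  · simp [hv]

theorem done_cons_of_done {P : List ℕ} {u v : ℕ} (h : I.done P u = true) :
    I.done (v :: P) u = true := by
  rw [done_iff] at *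
  exact fun w hw ha => List.mem_cons_of_mem v (h w hw ha)

theorem adj_eq_false_of_done {P : List ℕ} {u v : ℕ} (hv : v ∈ I.rest P) (h : I.done P u = true) :
    I.adj u v = false := by
  rw [mem_rest] at hv
  rw [done_iff] at h
  by_contra ha
  exact hv.2 (h v hv.1 (by simpa using ha))

theorem done_of_done_cons {P : List ℕ} {u v : ℕ} (h : I.done (v :: P) u = true)
    (ha : I.adj u v = false) : I.done P u = true := by
  rw [done_iff] at *
  intro w hw haw
  rcases List.mem_cons.1 (h w hw haw) with rfl | h
  · simp [ha] at haw
  · exact h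

/-- The effect of a decision about the vertex `v` on a set of vertices. -/
def decideOn (X : Finset ℕ) (v : ℕ) (b : Bool) : Finset ℕ := bif b then insert v X else X

theorem count_decideOn {X : Finset ℕ} {v u : ℕ} (hv : v ∉ X) (b : Bool) :
    I.count (decideOn X v b) u = bif b && I.adj u v then I.count X u + 1 else I.count X u := by
  cases b
  · rfl
  · exact I.count_insert hv

/-- The summary keeps the true count wherever `u` is not yet done, so updating it is exact there. At
the other vertices the entry has been erased. -/
theorem place_getD {P : List ℕ} {X : Finset ℕ} {u v : ℕ} {b : Bool} (hu : u < I.numVertices)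
    (hX : v ∉ X) (hd : I.done P u = false) :
    (I.place v (I.summary P X).1 b).getD u 0 = I.count (decideOn X v b) u := by
  rw [place, getD_map_range _ hu, summary, getD_map_range _ hu, hd, I.count_decideOn hX]
  rfl

theorem forget_place {P : List ℕ} {X : Finset ℕ} {v : ℕ} {b : Bool} (hX : v ∉ X) :
    (I.forget (v :: P) (I.place v (I.summary P X).1 b), bif b then X.card + 1 else X.card) =
      I.summary (v :: P) (decideOn X v b) := by
  refine Prod.ext (List.map_congr_left fun u hu => ?_) ?_
  · cases hd : I.done (v :: P) u
    · rw [I.place_getD (List.mem_range.1 hu) hX]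
      by_contra h
      rw [Bool.not_eq_false] at h
      rw [I.done_cons_of_done h] at hd
      cases hd
    · rfl
  · cases b
    · rfl
    · exact (Finset.card_insert_of_notMem hX).symm

/-- A vertex that was done before is not adjacent to `v`, so its count does not change and its
condition persists. A vertex that becomes done through `v` must be adjacent to `v`. Hence testing
the done neighbours of `v`, as `approved` does, covers exactly the new conditions, and the summary
suffices for it because those neighbours were not done before. -/
theorem isPartial_decideOn {P : List ℕ} {X : Finset ℕ} {v : ℕ} {b : Bool} (hv : v ∈ I.rest P)
    (hX : ∀ w ∈ X, w ∈ P) : I.IsPartial (v :: P) (decideOn X v b) ↔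
      I.IsPartial P X ∧ (b = true → I.occ v = false) ∧
        I.approved (v :: P) v (I.place v (I.summary P X).1 b) = true := by
  have hvX : v ∉ X := fun h => (I.mem_rest.1 hv).2 (hX v h)
  have h₁ : (∀ w ∈ decideOn X v b, w ∈ v :: P ∧ I.occ w = false) ↔
      (∀ w ∈ X, w ∈ P ∧ I.occ w = false) ∧ (b = true → I.occ v = false) := by
    cases b
    · simp only [decideOn, cond_false, Bool.false_eq_true, false_imp_iff, and_true]
      exact ⟨fun h w hw => ⟨hX w hw, (h w hw).2⟩,
        fun h w hw => ⟨List.mem_cons_of_mem v (hX w hw), (h w hw).2⟩⟩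
    · simp only [decideOn, cond_true, Finset.mem_insert, forall_eq_or_imp, true_imp_iff,
        List.mem_cons_self, true_and]
      exact ⟨fun h => ⟨fun w hw => ⟨hX w hw, (h.2 w hw).2⟩, h.1⟩,
        fun h => ⟨h.2, fun w hw => ⟨List.mem_cons_of_mem v (hX w hw), (h.1 w hw).2⟩⟩⟩
  have h₂ : (∀ u < I.numVertices, I.done (v :: P) u = true →
      I.ok u (I.count (decideOn X v b) u) = true) ↔
      (∀ u < I.numVertices, I.done P u = true → I.ok u (I.count X u) = true) ∧
        I.approved (v :: P) v (I.place v (I.summary P X).1 b) = true := by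
    simp only [approved, List.all_eq_true, List.mem_range, Bool.or_eq_true, Bool.not_eq_true',
      ← Bool.not_eq_true, ← imp_iff_not_or, Bool.and_eq_true]
    have hcount {u : ℕ} (ha : I.adj u v = false) :
        I.count (decideOn X v b) u = I.count X u := by
      rw [I.count_decideOn hvX, ha, Bool.and_false, cond_false]
    have hget {u : ℕ} (hu : u < I.numVertices) (ha : I.adj u v = true) :
        (I.place v (I.summary P X).1 b).getD u 0 = I.count (decideOn X v b) u := by
      refine I.place_getD hu hvX ?_
      by_contra h
      rw [I.adj_eq_false_of_done hv (by simpa using h)] at ha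
      cases ha
    constructor
    · intro h
      refine ⟨fun u hu hd => ?_, fun u hu ha => ?_⟩
      · rw [← hcount (I.adj_eq_false_of_done hv hd)]
        exact h u hu (I.done_cons_of_done hd)
      · rw [hget hu ha.1]
        exact h u hu ha.2
    · rintro ⟨h, h'⟩ u hu hd
      cases ha : I.adj u v
      · rw [hcount ha]
        exact h u hu (I.done_of_done_cons hd ha)
      · rw [← hget hu ha]
        exact h' u hu ⟨ha, hd⟩
  rw [IsPartial, h₁, h₂, IsPartial]
  tauto

theorem mem_extend {P : List ℕ} {v : ℕ} {p q : List ℕ × ℕ} : q ∈ I.extend P v p ↔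
    ∃ b, (b = true → I.occ v = false) ∧ I.approved (v :: P) v (I.place v p.1 b) = true ∧
      q = (I.forget (v :: P) (I.place v p.1 b), bif b then p.2 + 1 else p.2) := by
  have hb (b : Bool) : q ∈ I.extendBy P v p b ↔
      I.approved (v :: P) v (I.place v p.1 b) = true ∧
        q = (I.forget (v :: P) (I.place v p.1 b), bif b then p.2 + 1 else p.2) := by
    unfold extendBy
    cases I.approved (v :: P) v (I.place v p.1 b) <;> simp
  rw [extend, List.mem_append, hb, Bool.exists_bool]
  cases I.occ v
  · simp [hb]
  · simp

theorem mem_insertPair {l : List (List ℕ × ℕ)} {p q : List ℕ × ℕ} :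
    q ∈ insertPair l p ↔ q = p ∨ q ∈ l := by
  unfold insertPair
  cases h : l.any fun q => q.1 == p.1 && q.2 == p.2
  · simp
  · rw [List.any_eq_true] at h
    obtain ⟨x, hx, hxp⟩ := h
    have : x = p := by simpa [Prod.ext_iff] using hxp
    subst this
    simp only [cond_true, iff_or_self]
    rintro rfl
    exact hx

theorem nodup_insertPair {l : List (List ℕ × ℕ)} {p : List ℕ × ℕ} (hl : l.Nodup) :
    (insertPair l p).Nodup := by
  unfold insertPair
  cases h : l.any fun q => q.1 == p.1 && q.2 == p.2
  · refine List.nodup_cons.2 ⟨fun hp => ?_, hl⟩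
    rw [List.any_eq_false] at h
    exact h p hp (by simp)
  · exact hl

theorem mem_foldl_insertPair {l m : List (List ℕ × ℕ)} {q : List ℕ × ℕ} :
    q ∈ l.foldl insertPair m ↔ q ∈ l ∨ q ∈ m := by
  induction l generalizing m with
  | nil => simp
  | cons p l ih => rw [List.foldl_cons, ih, mem_insertPair, List.mem_cons]; tauto

theorem nodup_foldl_insertPair {l m : List (List ℕ × ℕ)} (hm : m.Nodup) :
    (l.foldl insertPair m).Nodup := by
  induction l generalizing m with
  | nil => exact hm
  | cons p l ih => exact ih (nodup_insertPair hm)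

theorem run_succ (k : ℕ) : I.run (k + 1) = I.next (I.run k) := by
  rw [run, List.range_succ, List.foldl_append]; rfl

theorem length_run (k : ℕ) : (I.run k).1.length = k := by
  induction k with
  | zero => rfl
  | succ k ih => rw [run_succ, next, List.length_cons, ih]

theorem choose_run {k : ℕ} (hk : k < I.numVertices) :
    I.choose (I.run k).1 ∈ I.rest (I.run k).1 :=
  I.choose_mem_rest (I.rest_ne_nil (by rwa [length_run]))

theorem run_subset {k : ℕ} (hk : k ≤ I.numVertices) :
    (I.run k).1.Nodup ∧ ∀ v ∈ (I.run k).1, v < I.numVertices := by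
  induction k with
  | zero => exact ⟨List.nodup_nil, by simp [run, start]⟩
  | succ k ih =>
    have h := I.mem_rest.1 (I.choose_run hk)
    have ih := ih (by omega)
    rw [run_succ, next]
    exact ⟨List.nodup_cons.2 ⟨h.2, ih.1⟩, List.forall_mem_cons.2 ⟨h.1, ih.2⟩⟩

theorem nodup_run (k : ℕ) : (I.run k).2.Nodup := by
  cases k with
  | zero =>
    simp only [run, start, List.range_zero, List.foldl_nil]
    cases I.labels.all fun u => !I.done [] u || I.ok u 0 <;> simp
  | succ k => rw [run_succ]; exact nodup_foldl_insertPair List.nodup_nil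

/-- The invariant of the algorithm. Whether `X` extends by `v`, and the summary of the extension,
depend on `X` only through its summary, so merging equal summaries loses nothing. Conversely, every
partial solution `X` arises from `X.erase v` by one decision. -/
theorem mem_run {k : ℕ} (hk : k ≤ I.numVertices) (p : List ℕ × ℕ) : p ∈ (I.run k).2 ↔
    ∃ X, I.IsPartial (I.run k).1 X ∧ p = I.summary (I.run k).1 X := by
  induction k generalizing p with
  | zero =>
    -- Isolated vertices are done before anything is processed. No later step would check their
    -- inhabitants, so the initial state has to.
    have h₁ : (I.labels.all fun u => !I.done [] u || I.ok u 0) = true ↔ I.IsPartial [] ∅ := by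
      simp only [List.all_eq_true, List.mem_range, Bool.or_eq_true, Bool.not_eq_true',
        ← Bool.not_eq_true, ← imp_iff_not_or, IsPartial]
      simp [count]
    have h₂ : (I.labels.map fun _ => 0, 0) = I.summary [] ∅ := by
      simp [summary, count]
    have h₃ (X : Finset ℕ) (hX : I.IsPartial [] X) : X = ∅ :=
      Finset.eq_empty_of_forall_notMem fun v hv => by simpa using (hX.1 v hv).1
    simp only [run, start, List.range_zero, List.foldl_nil]
    cases h : I.labels.all fun u => !I.done [] u || I.ok u 0
    · rw [h] at h₁
      simp only [cond_false, List.not_mem_nil, false_iff, not_exists, not_and]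
      intro X hX
      rw [h₃ X hX] at hX
      exact absurd (h₁.2 hX) Bool.false_ne_true
    · rw [h₂]
      simp only [cond_true, List.mem_singleton]
      constructor
      · exact fun hp => ⟨∅, h₁.1 h, hp⟩
      · rintro ⟨X, hX, rfl⟩
        rw [h₃ X hX]
  | succ k ih =>
    have hv := I.choose_run hk
    have ih := ih (by omega)
    rw [run_succ, next]
    generalize I.run k = s at *
    generalize I.choose s.1 = v at *
    simp only [mem_foldl_insertPair, List.not_mem_nil, or_false, List.mem_flatMap]
    constructor
    · rintro ⟨q, hq, hp⟩
      obtain ⟨X, hX, rfl⟩ := (ih q).1 hq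
      obtain ⟨b, hb₁, hb₂, rfl⟩ := I.mem_extend.1 hp
      have hXP : ∀ w ∈ X, w ∈ s.1 := fun w hw => (hX.1 w hw).1
      exact ⟨decideOn X v b, (I.isPartial_decideOn hv hXP).2 ⟨hX, hb₁, hb₂⟩,
        I.forget_place fun h => (I.mem_rest.1 hv).2 (hXP v h)⟩
    · rintro ⟨X, hX, rfl⟩
      have hXP : ∀ w ∈ X.erase v, w ∈ s.1 := by
        intro w hw
        rw [Finset.mem_erase] at hw
        exact (List.mem_cons.1 (hX.1 w hw.2).1).resolve_left hw.1
      obtain ⟨b, hb⟩ : ∃ b, X = decideOn (X.erase v) v b := by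
        by_cases h : v ∈ X
        · exact ⟨true, (Finset.insert_erase h).symm⟩
        · exact ⟨false, (Finset.erase_eq_of_notMem h).symm⟩
      rw [hb] at hX
      obtain ⟨h₁, h₂, h₃⟩ := (I.isPartial_decideOn hv hXP).1 hX
      refine ⟨_, (ih _).2 ⟨_, h₁, rfl⟩, I.mem_extend.2 ⟨b, h₂, h₃, ?_⟩⟩
      conv_lhs => rw [hb]
      exact (I.forget_place (Finset.notMem_erase v X)).symm

theorem answer_eq_true_iff : I.answer = true ↔ ∃ X : Finset ℕ,
    (∀ v ∈ X, v < I.numVertices ∧ I.occ v = false) ∧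
      (∀ u < I.numVertices, I.ok u (I.count X u) = true) ∧ X.card = I.numRefugees := by
  have hall : ∀ v, v ∈ (I.run I.numVertices).1 ↔ v < I.numVertices := by
    have h := I.run_subset le_rfl
    have hsub : (I.run I.numVertices).1.toFinset ⊆ Finset.range I.numVertices := by
      intro v hv
      exact Finset.mem_range.2 (h.2 v (by simpa using hv))
    have := Finset.eq_of_subset_of_card_le hsub (by
      rw [List.toFinset_card_of_nodup h.1, length_run, Finset.card_range])
    intro v
    rw [← List.mem_toFinset, this, Finset.mem_range]
  have hdone (u : ℕ) : I.done (I.run I.numVertices).1 u = true :=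
    I.done_iff.2 fun w hw _ => (hall w).2 hw
  simp only [answer, List.any_eq_true, beq_iff_eq, I.mem_run le_rfl, IsPartial, hall, hdone,
    true_imp_iff]
  constructor
  · rintro ⟨_, ⟨X, hX, rfl⟩, h⟩
    exact ⟨X, hX.1, hX.2, h⟩
  · rintro ⟨X, h₁, h₂, h₃⟩
    exact ⟨_, ⟨X, ⟨h₁, h₂⟩, rfl⟩, h₃⟩

end correctness

end ARHInstance

/-! ### At most two pending vertices, and the size of the table -/

namespace ARHInstance

variable (I : ARHInstance)

section bound

/-- The labels of the neighbours of a vertex. -/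
def nbrs (u : ℕ) : Finset ℕ := {v ∈ Finset.range I.numVertices | I.adj u v = true}

/-- The pending vertices. -/
def pendings (P : List ℕ) : Finset ℕ := {u ∈ Finset.range I.numVertices | I.pending P u = true}

theorem mem_nbrs {u v : ℕ} : v ∈ I.nbrs u ↔ I.adj u v = true := by
  rw [nbrs, Finset.mem_filter, Finset.mem_range]
  exact ⟨fun h => h.2, fun h => ⟨(I.lt_of_adj h).2, h⟩⟩

theorem mem_pendings {P : List ℕ} {u : ℕ} : u ∈ I.pendings P ↔ I.pending P u = true := by
  rw [pendings, Finset.mem_filter, Finset.mem_range]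
  refine ⟨fun h => h.2, fun h => ⟨?_, h⟩⟩
  obtain ⟨-, w, -, ha, -⟩ := I.pending_iff.1 h
  exact (I.lt_of_adj ha).1

theorem card_nbrs_le (h : I.topology.maxDegree ≤ 2) (u : ℕ) : (I.nbrs u).card ≤ 2 := by
  by_cases hu : u < I.numVertices
  · refine le_trans ?_ ((I.topology.degree_le_maxDegree ⟨u, hu⟩).trans h)
    rw [← SimpleGraph.card_neighborFinset_eq_degree,
      ← Finset.card_map (Fin.valEmbedding (n := I.numVertices))]
    refine Finset.card_le_card fun v hv => ?_
    rw [mem_nbrs] at hv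
    have hv' := (I.lt_of_adj hv).2
    rw [adj, dif_pos ⟨hu, hv'⟩, decide_eq_true_eq] at hv
    exact Finset.mem_map.2 ⟨⟨v, hv'⟩, by simpa using hv, rfl⟩
  · have : I.nbrs u = ∅ := Finset.eq_empty_of_forall_notMem fun v hv =>
      hu (I.lt_of_adj (I.mem_nbrs.1 hv)).1
    simp [this]

theorem pendings_cons_subset (P : List ℕ) (v : ℕ) :
    I.pendings (v :: P) ⊆ I.pendings P ∪ I.nbrs v := by
  intro u hu
  rw [mem_pendings, pending_iff] at hu
  obtain ⟨hd, w, hw, ha, hm⟩ := hu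
  rw [Finset.mem_union, mem_pendings, mem_nbrs]
  rcases List.mem_cons.1 hm with rfl | hm
  · exact Or.inr (by rwa [adj_comm])
  · refine Or.inl (I.pending_iff.2 ⟨?_, w, hw, ha, hm⟩)
    by_contra h
    rw [I.done_cons_of_done (by simpa using h)] at hd
    cases hd

/-- With no pending vertex, only the at most two neighbours of the chosen vertex can become pending.
Otherwise that vertex `v` is adjacent to a pending `u₀`, which becomes done. One of the at most two
pending vertices and one of the at most two neighbours of `v` is thus discarded, and `1 + 1` remain.
-/
theorem card_pendings_next_le (h : I.topology.maxDegree ≤ 2) {P : List ℕ}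
    (hP : I.rest P ≠ []) (hc : (I.pendings P).card ≤ 2) :
    (I.pendings (I.choose P :: P)).card ≤ 2 := by
  have hv := I.mem_rest.1 (I.choose_mem_rest hP)
  rcases (I.pendings P).eq_empty_or_nonempty with he | ⟨u, hu⟩
  · refine (Finset.card_le_card (I.pendings_cons_subset P _)).trans ?_
    rw [he, Finset.empty_union]
    exact I.card_nbrs_le h _
  · have hpref : I.preferred P ≠ [] := by
      obtain ⟨hd, -⟩ := I.pending_iff.1 (I.mem_pendings.1 hu)
      have : ¬ ∀ w < I.numVertices, I.adj u w = true → w ∈ P := by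
        rw [← done_iff, hd]; simp
      push Not at this
      obtain ⟨w, hw, ha, hwP⟩ := this
      exact List.ne_nil_of_mem (I.mem_preferred.2 ⟨I.mem_rest.2 ⟨hw, hwP⟩, u, (I.lt_of_adj ha).1,
        I.mem_pendings.1 hu, ha⟩)
    obtain ⟨-, u₀, -, hp₀, ha₀⟩ := I.mem_preferred.1 (I.choose_mem_preferred hpref)
    generalize I.choose P = v at *
    -- `u₀` has a processed neighbour `w` and the unprocessed neighbour `v`. A neighbour `x` outside
    -- `v :: P` would be a third one.
    have hdone : I.done (v :: P) u₀ = true := by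
      obtain ⟨-, w, -, haw, hwP⟩ := I.pending_iff.1 hp₀
      have hwv : w ≠ v := fun h => hv.2 (h ▸ hwP)
      refine I.done_iff.2 fun x _ hax => ?_
      by_contra hx
      rw [List.mem_cons, not_or] at hx
      have hsub : ({x, w, v} : Finset ℕ) ⊆ I.nbrs u₀ := by
        intro z hz
        rw [mem_nbrs]
        simp only [Finset.mem_insert, Finset.mem_singleton] at hz
        rcases hz with rfl | rfl | rfl <;> assumption
      have h₃ : ({x, w, v} : Finset ℕ).card = 3 :=
        Finset.card_eq_three.2 ⟨x, w, v, fun h => hx.2 (h ▸ hwP), hx.1, hwv, rfl⟩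
      have := (Finset.card_le_card hsub).trans (I.card_nbrs_le h u₀)
      omega
    have hsub : I.pendings (v :: P) ⊆ (I.pendings P).erase u₀ ∪ (I.nbrs v).erase u₀ := by
      intro u hu
      have hne : u ≠ u₀ := by
        rintro rfl
        have := (I.pending_iff.1 (I.mem_pendings.1 hu)).1
        rw [hdone] at this
        cases this
      rw [← Finset.erase_union_distrib, Finset.mem_erase]
      exact ⟨hne, I.pendings_cons_subset P v hu⟩
    have h₁ := Finset.card_erase_of_mem (I.mem_pendings.2 hp₀)
    have h₂ := Finset.card_erase_of_mem (I.mem_nbrs.2 (by rwa [adj_comm] : I.adj v u₀ = true))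
    have h₃ := I.card_nbrs_le h v
    have := (Finset.card_le_card hsub).trans (Finset.card_union_le _ _)
    omega

theorem card_pendings_run_le (h : I.topology.maxDegree ≤ 2) {k : ℕ} (hk : k ≤ I.numVertices) :
    (I.pendings (I.run k).1).card ≤ 2 := by
  induction k with
  | zero =>
    have : I.pendings (I.run 0).1 = ∅ := Finset.eq_empty_of_forall_notMem fun u hu => by
      obtain ⟨-, w, -, -, hw⟩ := I.pending_iff.1 (I.mem_pendings.1 hu)
      simp [run, start] at hw
    simp [this]
  | succ k ih =>
    rw [run_succ]
    exact I.card_pendings_next_le h (I.rest_ne_nil (by rwa [length_run])) (ih (by omega))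

theorem card_le_of_isPartial_run {k : ℕ} (hk : k ≤ I.numVertices) {X : Finset ℕ}
    (hX : I.IsPartial (I.run k).1 X) : X.card ≤ I.numVertices := by
  have : X ⊆ Finset.range I.numVertices := fun v hv =>
    Finset.mem_range.2 ((I.run_subset hk).2 v (hX.1 v hv).1)
  simpa using Finset.card_le_card this

theorem count_le_card (X : Finset ℕ) (u : ℕ) : I.count X u ≤ X.card :=
  Finset.card_filter_le _ _

/-- A summary is determined by its values on the pending set `D` and by the total, each at most `n`,
where `n` is the number of vertices. This gives at most `(n + 1) ^ (D.card + 1)` summaries, and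
`D.card ≤ 2`. Since the table has no duplicates, its length is bounded too. -/
theorem length_run_le (h : I.topology.maxDegree ≤ 2) {k : ℕ} (hk : k ≤ I.numVertices) :
    (I.run k).2.length ≤ (I.numVertices + 1) ^ 3 := by
  set D := I.pendings (I.run k).1 with hD
  let F : Finset ((D → ℕ) × ℕ) :=
    Fintype.piFinset (fun _ => Finset.range (I.numVertices + 1)) ×ˢ
      Finset.range (I.numVertices + 1)
  let φ : (D → ℕ) × ℕ → List ℕ × ℕ := fun p =>
    (I.labels.map fun u => if hu : u ∈ D then p.1 ⟨u, hu⟩ else 0, p.2)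
  have hsub : (I.run k).2.toFinset ⊆ F.image φ := by
    intro p hp
    obtain ⟨X, hX, rfl⟩ := (I.mem_run hk p).1 (List.mem_toFinset.1 hp)
    have hcard := I.card_le_of_isPartial_run hk hX
    refine Finset.mem_image.2 ⟨(fun u => I.count X u, X.card), ?_, ?_⟩
    · simp only [F, Finset.mem_product, Fintype.mem_piFinset, Finset.mem_range]
      exact ⟨fun u => by have := I.count_le_card X u; omega, by omega⟩
    · refine Prod.ext (List.map_congr_left fun u hu => ?_) rfl
      split
      case isTrue hu' =>
        rw [hD, mem_pendings, pending_iff] at hu'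
        rw [hu'.1]; rfl
      -- A vertex that is not pending is either done, with its entry erased, or has no processed
      -- neighbour, and then no neighbour in `X`.
      case isFalse hu' =>
        rw [hD, mem_pendings, pending_iff, not_and] at hu'
        cases hd : I.done (I.run k).1 u
        · refine (Finset.card_eq_zero.2 (Finset.filter_eq_empty_iff.2 fun v hv ha => ?_)).symm
          exact hu' hd ⟨v, (I.lt_of_adj ha).2, ha, (hX.1 v hv).1⟩
        · rfl
  have hF : F.card ≤ (I.numVertices + 1) ^ 3 := by
    rw [Finset.card_product, Fintype.card_piFinset, Finset.prod_const, Finset.card_univ,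
      Finset.card_range, ← pow_succ, Fintype.card_coe]
    exact Nat.pow_le_pow_right (by omega)
      (Nat.succ_le_succ (I.card_pendings_run_le h hk))
  rw [← List.toFinset_card_of_nodup (I.nodup_run k)]
  exact (Finset.card_le_card hsub).trans (Finset.card_image_le.trans hF)

theorem treeSize_nats_le {l : List ℕ} {n : ℕ} (hl : l.length ≤ n) (h : ∀ k ∈ l, k ≤ n) :
    treeSize l ≤ n * (2 * n + 2) + 1 := by
  refine (treeSize_le_length_mul l (2 * n + 1) fun k hk => ?_).trans (by gcongr)
  rw [treeSize_nat]
  have := h k hk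
  omega

theorem treeSize_run_le (h : I.topology.maxDegree ≤ 2) {k : ℕ} (hk : k ≤ I.numVertices) :
    treeSize (I.run k) ≤ I.numVertices * (2 * I.numVertices + 2) + 1 +
      ((I.numVertices + 1) ^ 3 * (I.numVertices * (2 * I.numVertices + 2) + 1 +
        (2 * I.numVertices + 1) + 1 + 1) + 1) + 1 := by
  rw [treeSize_prod]
  gcongr
  · exact treeSize_nats_le (by rwa [length_run]) fun v hv => ((I.run_subset hk).2 v hv).le
  · refine (treeSize_le_length_mul _ _ fun p hp => ?_).trans
      (by gcongr; exact I.length_run_le h hk)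
    obtain ⟨X, hX, rfl⟩ := (I.mem_run hk p).1 hp
    have hcard := I.card_le_of_isPartial_run hk hX
    rw [treeSize_prod]
    gcongr
    · refine treeSize_nats_le (by simp [summary]) fun c hc => ?_
      obtain ⟨u, -, rfl⟩ := List.mem_map.1 hc
      cases I.done (I.run k).1 u
      · exact (I.count_le_card X u).trans hcard
      · exact Nat.zero_le _
    · rw [treeSize_nat, summary]
      dsimp only
      omega

end bound

/-! ### Housings as sets of occupied vertices -/

section isYes

theorem occ_eq_false_iff (v : I.Vertex) : I.occ v = false ↔ v ∈ I.unoccupied := by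
  simp [occ, unoccupied, Fin.ext_iff]

theorem ncard_neighborSet_inter {O : Set I.Vertex} {X : Finset ℕ}
    (hO : ∀ v : I.Vertex, (v : ℕ) ∈ X ↔ v ∈ O) (u : I.Vertex) :
    (I.topology.neighborSet u ∩ O).ncard = I.count X u := by
  rw [← Set.ncard_image_of_injective _ Fin.val_injective, count, ← Set.ncard_coe_finset]
  congr 1
  ext v
  simp only [Set.mem_image, Set.mem_inter_iff, SimpleGraph.mem_neighborSet, Finset.coe_filter,
    Set.mem_ofPred_eq]
  constructor
  · rintro ⟨v, ⟨ha, hv⟩, rfl⟩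
    exact ⟨(hO v).2 hv, by simpa [adj] using ha⟩
  · rintro ⟨hv, ha⟩
    have hlt := I.lt_of_adj ha
    rw [adj, dif_pos hlt, decide_eq_true_eq] at ha
    exact ⟨⟨v, hlt.2⟩, ⟨ha, (hO _).1 hv⟩, rfl⟩

theorem forall_ok_iff {O : Set I.Vertex} {X : Finset ℕ}
    (hO : ∀ v : I.Vertex, (v : ℕ) ∈ X ↔ v ∈ O) :
    (∀ u < I.numVertices, I.ok u (I.count X u) = true) ↔
      ∀ i, (I.topology.neighborSet (I.assignment i) ∩ O).ncard ∈ I.approval i := by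
  simp only [I.ncard_neighborSet_inter hO, ok, decide_eq_true_eq]
  constructor
  · exact fun h i => h _ (I.assignment i).2 i rfl
  · rintro h u - i rfl
    exact h i

/-- Approval depends only on the image of a housing. Conversely, any set of unoccupied vertices with
`numRefugees` elements is the image of one, through an arbitrary numbering of its elements. -/
theorem isYes_iff : I.IsYes ↔ I.answer = true := by
  rw [answer_eq_true_iff]
  constructor
  · rintro ⟨π, hπ⟩
    have hinj : Function.Injective fun r => ((π.place r : I.Vertex) : ℕ) :=
      Fin.val_injective.comp (Subtype.val_injective.comp π.place_injective)
    refine ⟨Finset.univ.image fun r => ((π.place r : I.Vertex) : ℕ), ?_,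
      (I.forall_ok_iff fun v => ?_).2 hπ, ?_⟩
    · intro v hv
      obtain ⟨r, -, rfl⟩ := Finset.mem_image.1 hv
      exact ⟨(π.place r : I.Vertex).2, (I.occ_eq_false_iff _).2 (π.place r).2⟩
    · simp [Housing.occupied, Fin.ext_iff]
    · rw [Finset.card_image_of_injective _ hinj, Finset.card_fin]
  · rintro ⟨X, hX, hok, hcard⟩
    let e := (X.equivFinOfCardEq hcard).symm
    refine ⟨⟨fun r => ⟨⟨e r, (hX _ (e r).2).1⟩, (I.occ_eq_false_iff _).1 (hX _ (e r).2).2⟩,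
      fun r s hrs => ?_⟩, (I.forall_ok_iff fun v => ?_).1 hok⟩
    · exact e.injective (Subtype.ext (by simpa using hrs))
    · simp only [Housing.occupied, Set.mem_range, Fin.ext_iff]
      constructor
      · exact fun hv => ⟨e.symm ⟨v, hv⟩, by simp⟩
      · rintro ⟨r, hr⟩
        rw [← hr]
        exact (e r).2

end isYes

end ARHInstance

/-! ### The dynamic program runs in polynomial time -/

namespace PolyTime

open ARHInstance

variable {α : Type*} [TreeEncoding α] {I : α → ARHInstance} {P y : α → List ℕ} {u v : α → ℕ}
  {b : α → Bool} {p : α → List ℕ × ℕ}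

theorem contains (hP : PolyTime P) (hv : PolyTime v) : PolyTime fun a => (P a).any (· == v a) :=
  any (p := fun a w => w == v a) hP (snd.beq (hv.comp fst))

theorem labels (hI : PolyTime I) : PolyTime fun a => (I a).labels := hI.numVertices.range

theorem done (hI : PolyTime I) (hP : PolyTime P) (hu : PolyTime u) :
    PolyTime fun a => (I a).done (P a) (u a) :=
  all (p := fun a w => !(I a).adj (u a) w || (P a).any (· == w)) hI.labels
    ((adj (hI.comp fst) (hu.comp fst) snd).not.or ((hP.comp fst).contains snd))

theorem pending (hI : PolyTime I) (hP : PolyTime P) (hu : PolyTime u) :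
    PolyTime fun a => (I a).pending (P a) (u a) :=
  (done hI hP hu).not.and (any (p := fun a w => (I a).adj (u a) w && (P a).any (· == w)) hI.labels
    ((adj (hI.comp fst) (hu.comp fst) snd).and ((hP.comp fst).contains snd)))

theorem rest (hI : PolyTime I) (hP : PolyTime P) : PolyTime fun a => (I a).rest (P a) :=
  filter (p := fun a v => !(P a).any (· == v)) hI.labels ((hP.comp fst).contains snd).not

theorem preferred (hI : PolyTime I) (hP : PolyTime P) :
    PolyTime fun a => (I a).preferred (P a) := by
  have hI' := hI.comp (fst (β := ℕ))
  have hP' := hP.comp (fst (β := ℕ))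
  exact filter (p := fun a v => (I a).labels.any fun u => (I a).pending (P a) u && (I a).adj u v)
    (rest hI hP) (any (p := fun a u => (I a.1).pending (P a.1) u && (I a.1).adj u a.2) hI'.labels
      ((pending (hI'.comp fst) (hP'.comp fst) snd).and (adj (hI'.comp fst) snd (snd.comp fst))))

theorem choose (hI : PolyTime I) (hP : PolyTime P) : PolyTime fun a => (I a).choose (P a) :=
  ((preferred hI hP).append (rest hI hP)).headD (.const 0)

theorem place (hI : PolyTime I) (hv : PolyTime v) (hy : PolyTime y) (hb : PolyTime b) :
    PolyTime fun a => (I a).place (v a) (y a) (b a) := by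
  have hget : PolyTime fun q : α × ℕ => (y q.1).getD q.2 0 := (hy.comp fst).getD snd (.const 0)
  exact map (g := fun a u => bif b a && (I a).adj u (v a) then (y a).getD u 0 + 1
    else (y a).getD u 0) hI.labels
    (cond ((hb.comp fst).and (adj (hI.comp fst) snd (hv.comp fst))) hget.succ hget)

theorem approved (hI : PolyTime I) (hP : PolyTime P) (hv : PolyTime v) (hy : PolyTime y) :
    PolyTime fun a => (I a).approved (P a) (v a) (y a) :=
  all (p := fun a u => !((I a).adj u (v a) && (I a).done (P a) u) || (I a).ok u ((y a).getD u 0))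
    hI.labels (((adj (hI.comp fst) snd (hv.comp fst)).and
      (done (hI.comp fst) (hP.comp fst) snd)).not.or
      (ok (hI.comp fst) snd ((hy.comp fst).getD snd (.const 0))))

theorem forget (hI : PolyTime I) (hP : PolyTime P) (hy : PolyTime y) :
    PolyTime fun a => (I a).forget (P a) (y a) :=
  map (g := fun a u => bif (I a).done (P a) u then 0 else (y a).getD u 0) hI.labels
    (cond (done (hI.comp fst) (hP.comp fst) snd) (.const 0) ((hy.comp fst).getD snd (.const 0)))

theorem extendBy (hI : PolyTime I) (hP : PolyTime P) (hv : PolyTime v) (hp : PolyTime p)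
    (hb : PolyTime b) : PolyTime fun a => (I a).extendBy (P a) (v a) (p a) (b a) := by
  have hy := place hI hv (fst.comp hp) hb
  have hc := snd.comp hp
  exact cond (approved hI (hv.cons hP) hv hy)
    (((forget hI (hv.cons hP) hy).pair (cond hb hc.succ hc)).cons (.const [])) (.const [])

theorem extend (hI : PolyTime I) (hP : PolyTime P) (hv : PolyTime v) (hp : PolyTime p) :
    PolyTime fun a => (I a).extend (P a) (v a) (p a) :=
  (extendBy hI hP hv hp (.const false)).append
    (cond (occ hI hv) (.const []) (extendBy hI hP hv hp (.const true)))

theorem insertPair {l : α → List (List ℕ × ℕ)} (hl : PolyTime l) (hp : PolyTime p) :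
    PolyTime fun a => insertPair (l a) (p a) :=
  cond (any (p := fun a q => q.1 == (p a).1 && q.2 == (p a).2) hl
    (((fst.comp snd).listBeq (fst.comp (hp.comp fst))).and
      ((snd.comp snd).beq (snd.comp (hp.comp fst))))) hl (hp.cons hl)

theorem foldl_insertPair {l : α → List (List ℕ × ℕ)} (hl : PolyTime l) :
    PolyTime fun a => (l a).foldl ARHInstance.insertPair [] := by
  refine foldl_of_step (h := fun _ => ARHInstance.insertPair) hl (.const [])
    ((fst.comp snd).insertPair (snd.comp snd)) (hl.bounded.add (.const 1)) fun a x p hp => ?_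
  have := treeSize_le_of_mem hp
  unfold ARHInstance.insertPair
  cases x.any fun q => q.1 == p.1 && q.2 == p.2
  · rw [cond_false, treeSize_cons]; omega
  · rw [cond_true]; omega

theorem next {s : α → State} (hI : PolyTime I) (hs : PolyTime s) :
    PolyTime fun a => (I a).next (s a) := by
  have hP := fst.comp hs
  have hv := choose hI hP
  exact (hv.cons hP).pair (foldl_insertPair (flatMap
    (g := fun a p => (I a).extend (s a).1 ((I a).choose (s a).1) p) (snd.comp hs)
    (extend (hI.comp fst) (hP.comp fst) (hv.comp fst) snd)))

theorem start (hI : PolyTime I) : PolyTime fun a => (I a).start :=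
  (PolyTime.const []).pair (cond (all (p := fun a u => !(I a).done [] u || (I a).ok u 0) hI.labels
    ((done (hI.comp fst) (.const []) snd).not.or (ok (hI.comp fst) snd (.const 0))))
    (((map (g := fun _ _ => 0) hI.labels (.const 0)).pair (.const 0)).cons (.const []))
    (.const []))

/-- One step is polynomial in the current state for every graph, but iterating it could let the
state grow exponentially. The degree bound, available from the subtype, excludes this by
`treeSize_run_le`. -/
theorem answer : PolyTime fun I : {I : ARHInstance // I.topology.maxDegree ≤ 2} => I.1.answer := by
  have hI : PolyTime fun I : {I : ARHInstance // I.topology.maxDegree ≤ 2} => I.1 := val _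
  have hn : PolyBounded fun I : {I : ARHInstance // I.topology.maxDegree ≤ 2} =>
      I.1.numVertices :=
    hI.numVertices.bounded.of_le fun I => by rw [treeSize_nat]; omega
  have h₁ := (hn.mul (((PolyBounded.const 2).mul hn).add (.const 2))).add (.const 1)
  have hrun : PolyTime fun I : {I : ARHInstance // I.topology.maxDegree ≤ 2} =>
      I.1.run I.1.numVertices := by
    refine foldl (h := fun I s _ => I.1.next s) hI.labels (start hI)
      (next (hI.comp fst) (fst.comp snd))
      ((h₁.add ((((hn.add (.const 1)).pow 3).mul (((h₁.add (((PolyBounded.const 2).mul hn).add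
        (.const 1))).add (.const 1)).add (.const 1))).add (.const 1))).add (.const 1))
      fun I l₁ l₂ hl => ?_
    have hlen : l₁.length ≤ I.1.numVertices := by
      have := congrArg List.length hl
      simp at this; omega
    -- A prefix of a range is a range, so each intermediate value of the fold is the state `run k`
    -- for some `k` up to the number of vertices.
    have hl₁ : l₁ = List.range l₁.length := by
      refine List.ext_getElem (by simp) fun i hi _ => ?_
      have : I.1.labels[i]'(by simp; omega) = l₁[i] := by simp [hl, hi]
      rw [← this]; simp
    rw [hl₁]
    exact I.1.treeSize_run_le I.2 hlen
  exact any (p := fun I p => p.2 == I.1.numRefugees) (snd.comp hrun)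
    ((snd.comp snd).beq (hI.comp fst).numRefugees)

end PolyTime

open Classical in
theorem PolyTime.isYes :
    PolyTime fun I : {I : ARHInstance // I.topology.maxDegree ≤ 2} => decide I.1.IsYes :=
  PolyTime.answer.of_enc fun I => by
    congr 1
    rw [Bool.eq_iff_iff, decide_eq_true_eq]
    exact I.1.isYes_iff

theorem mainTheorem2 :
    ARHInstance.SolvableInPolyTimeOn (fun I => I.topology.maxDegree ≤ 2) := by
  exact PolyTime.tm2ComputableInPolyTime
    (α := {I : ARHInstance // I.topology.maxDegree ≤ 2}) (w := fun I => I.1.encode)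
    (fun _ => rfl) PolyTime.isYes
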